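/- Let $\Omega=(l_1,l_2)$, $0<t^*<t_1$, $\varepsilon_0>0$; all families below are indexed by $\varepsilon\in(0,\varepsilon_0)$, and $i=1,2$. **Fronts.** Let $\varphi_{i0}\in C^1[0,t_1]$, $\psi_0=\varphi_{20}-\varphi_{10}$ with $\psi_0>0$ on $[0,t^*)$ and $\psi_0<0$ on $(t^*,t_1]$, and $\tau=\psi_0(t)/\varepsilon$. Let $\varphi_i(\cdot,\varepsilon)\in C^1[0,t_1]$ have velocities $\varphi_{it}$ bounded uniformly in $t,\varepsilon$, and let $\varphi_i=\varphi_{i0}+\psi_0\,\varphi_{i1}(\tau,t)$ whenever $\psi_0\ne0$, where, uniformly in $t\in[0,t_1]$, $\varphi_{i1}$ and $\partial_\tau\varphi_{i1}$ are $O(\tau^{-1})$ for $\tau\ge1$ and $\varphi_{i1}-\varphi_{i1}^-(t)=O(|\tau|^{-1})$ for $\tau\le-1$. Put $\psi=\varphi_2-\varphi_1$, $x^*=(\varphi_1+\varphi_2)/2$. Let $\beta=\beta(\tau)\in C^1(\mathbb R)$ satisfy $0<\delta_1<\beta<\delta_2$, $|\beta'|\le\mathrm{const}$, and $\beta-1,\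 \beta'=O(\tau^{-1})$ as $\tau\to+\infty$; put $\eta=\beta(\tau)\psi/\varepsilon$. **Order function.** With $\omega_0=\tanh$, $a=\omega_0\big(\beta\frac{\varphi_1-x}{\varepsilon}\big)$, $b=\omega_0\big(\beta\frac{x-\varphi_2}{\varepsilon}\big)$, let $\check u=\tfrac12(1+a+b-ab)$. **Temperature.** Let $\gamma_i^\pm\in C^1[0,t_1]$. Let $B\in C^\infty(\mathbb R)$ with $B(+\infty)=1$, $B(-\infty)=0$ and all derivatives of order $\ge1$ decaying faster than any power. Let $e\in C_0^\infty(\Omega)$ equal $1$ on the closed interval between $\varphi_1(t,\varepsilon)$ and $\varphi_2(t,\varepsilon)$ for all $t\in[0,t_1]$ and all $\varepsilon$. Let $H$ be the Heaviside function, $D=H(x-\varphi_1)-H(x-\varphi_2)$, $P=(\varphi_1-x)(x-\varphi_2)/\psi$, and let $\gamma^-,\hat\gamma,I$ be the functions linear in $x$ with $$\gamma^-|_{\varphi_1}=\gamma_1^+,\quad \gamma^-|_{\varphi_2}=\gamma_2^-,\qquad \hat\gamma|_{\varphi_1}=\gamma_1^-,\quad\hat\gamma|_{\varphi_2}=\gamma_2^+,\qquad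 I|_{\varphi_i}=(-1)^{i+1}\varphi_{it}$$ (when $\psi=0$ they are taken to be constant in $x$, equal to the mean of the two prescribed values; there $D=0$, and the terms of $K$ below containing $D$ vanish). Put $\check T=K+I$ with $$K=\gamma_1^-(\varphi_1-x)H(\varphi_1-x)+\gamma_2^+(x-\varphi_2)H(x-\varphi_2)+\gamma^-P\,B(\tau)D-\hat\gamma P\,(1-B(\tau))D .$$ Let $\check\theta=e\check T+\check q+\hat q$, where $\check q,\hat q$ are functions of $(x,t,\varepsilon)$. **Heat equation for $\hat q$.** Let $J\subseteq[0,t_1]$ be a set of times (for instance $J=[0,t_1]$). Assume that $\hat q$ vanishes at $t=0$ and has zero boundary data (Dirichlet or Neumann at each end point), and that $w=\check q+\hat q+eI$ is continuous on $\overline\Omega\times[0,t_1]$ and, for $t\in J$, has for $x\neq\varphi_1,\varphi_2$ derivatives $w_t,w_x$ that are locally integrable in $x\in\Omega$ and satisfy, for every $t\in J$, in the sense of distributions in $x$, $$w_t-w_{xx}=F+\frac{\partial^2(\gamma^-P)}{\partial x^2}B(\tau)D-\frac{\partial^2(\hat\gamma P)}{\partial x^2}(1-B(\tau))D,\qquad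 F=-eK_t+2e'K_x+e''K ,$$ where $F$ is computed pointwise off the fronts; at instants where $\psi=0$ the last two terms mean their limit as $\psi\to0$, which is $\big[-(\gamma_1^++\gamma_2^-)B+(\gamma_1^-+\gamma_2^+)(1-B)\big]\delta(x-\varphi_1)$. **$\delta$-coefficient condition.** Let $$A_i=(-1)^{i+1}\frac{\varphi_{it}}2\,(2-B_{\dot00})-\frac{\beta'(\tau)\,\psi_0'(t)}{2\beta^2}B^z_{\dot00},$$ $$B_{\dot00}=\int_{\mathbb R}\dot\omega_0(z)\omega_0(-\eta-z)\,dz,\qquad B^z_{\dot00}=\int_{\mathbb R}z\dot\omega_0(z)\omega_0(-\eta-z)\,dz,$$ and assume that for every $\zeta\in C_0^\infty(\Omega)$ there is a $C$ with $\Big|\sum_{i=1}^2\{B(\tau)[\gamma_i^++\gamma_i^-]-A_i\}\,\zeta(\varphi_i)\Big|\le C\varepsilon$ for all $t\in J$, $\varepsilon\in(0,\varepsilon_0)$. **Conclusion.** The pair $(\check\theta,\check u)$ satisfies the heat equation of the phase field system up to $O(\varepsilon)$ in the weak sense: $\check u,\check\theta$ are continuous on $\overline\Omega\times[0,t_1]$;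 for $t\in J$ the derivatives $\check u_t,\check\theta_t,\check\theta_x$ exist for all but finitely many $x\in\Omega$, and $\check u_t+\check\theta_t$ and $\check\theta_x$ are locally integrable in $x$; and for every $\zeta\in C_0^\infty(\Omega)$ there is a constant $C$ such that for all $t\in J$ and $\varepsilon\in(0,\varepsilon_0)$ $$\Big|\int_\Omega(\check u_t+\check\theta_t)\,\zeta\,dx+\int_\Omega\check\theta_x\,\zeta_x\,dx\Big|\le C\varepsilon .$$ -/

import Mathlib

open Set Filter Topology MeasureTheory Asymptotics
open scoped ContDiff

noncomputable section

namespace PhaseField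

/-- The Heaviside function. -/
def heaviside (z : ℝ) : ℝ := if 0 ≤ z then 1 else 0

/-- Test functions `ζ ∈ C₀^∞(Ω)`, `Ω = (l₁, l₂)`. -/
structure IsTest (l₁ l₂ : ℝ) (ζ : ℝ → ℝ) : Prop where
  smooth : ContDiff ℝ ∞ ζ
  compact : HasCompactSupport ζ
  supp : tsupport ζ ⊆ Ioo l₁ l₂

/-- A family of distributions `f ε t`, depending on `ε` and `t` as parameters, is
`O_{D'}(ε)`, uniformly for `t` in the set `J` of times. -/
def IsODistr (l₁ l₂ ε₀ : ℝ) (J : Set ℝ) (f : ℝ → ℝ → (ℝ → ℝ) → ℝ) : Prop :=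
  ∀ ζ, IsTest l₁ l₂ ζ → ∃ C : ℝ, ∀ ε ∈ Ioo 0 ε₀, ∀ t ∈ J, |f ε t ζ| ≤ C * ε

/-- The data of the ansatz.  The index `0 : Fin 2` is the left front (`i = 1` in the usual
numbering) and `1 : Fin 2` the right one (`i = 2`). -/
structure Ansatz where
  /-- end points of `Ω` -/
  l₁ : ℝ
  l₂ : ℝ
  /-- final time -/
  t₁ : ℝ
  /-- instant of confluence -/
  ts : ℝ
  /-- the small parameter ranges over `(0, ε₀)` -/
  ε₀ : ℝ
  /-- the fronts `φ_{i0}(t)`: continued beyond `ts` -/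
  φ0 : Fin 2 → ℝ → ℝ
  /-- the corrections `φ_{i1}(τ, t)` and their limits as `τ → -∞` -/
  φ1 : Fin 2 → ℝ → ℝ → ℝ
  φ1m : Fin 2 → ℝ → ℝ
  /-- the approximate fronts, `φ i ε t = φ_i(t, ε)` -/
  φ : Fin 2 → ℝ → ℝ → ℝ
  /-- the width factor `β(τ)` and its bounds -/
  β : ℝ → ℝ
  δ₁ : ℝ
  δ₂ : ℝ
  /-- `γp i = γ_i^+` and `γm i = γ_i^-` -/
  γp : Fin 2 → ℝ → ℝ
  γm : Fin 2 → ℝ → ℝ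
  /-- the switching function `B(τ)` -/
  B : ℝ → ℝ
  /-- the cut-off function `e(x)` -/
  e : ℝ → ℝ
  l_lt : l₁ < l₂
  ts_mem : ts ∈ Ioo 0 t₁
  ε₀_pos : 0 < ε₀
  φ0_smooth : ∀ i, ContDiffOn ℝ 1 (φ0 i) (Icc 0 t₁)
  before : ∀ t ∈ Ico 0 ts, φ0 0 t < φ0 1 t
  after : ∀ t ∈ Ioc ts t₁, φ0 1 t < φ0 0 t
  φ1_top : ∃ C, ∀ i, ∀ t ∈ Icc 0 t₁, ∀ τ ≥ 1, |φ1 i τ t| ≤ C / τ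
  φ1_deriv_top : ∃ C, ∀ i, ∀ t ∈ Icc 0 t₁, ∀ τ ≥ 1,
    DifferentiableAt ℝ (fun σ => φ1 i σ t) τ ∧ |deriv (fun σ => φ1 i σ t) τ| ≤ C / τ
  φ1_bot : ∃ C, ∀ i, ∀ t ∈ Icc 0 t₁, ∀ τ ≤ -1, |φ1 i τ t - φ1m i t| ≤ C / |τ|
  /-- `φ_i = φ_{i0} + ψ₀ φ_{i1}(ψ₀ / ε, t)` with `ψ₀ = φ_{20} - φ_{10}`; where `ψ₀` vanishes,
  `φ_i` is continued smoothly (so that `φ_{i1}` may be singular at `τ = 0`) -/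
  φ_eq : ∀ i, ∀ ε ∈ Ioo 0 ε₀, ∀ t ∈ Icc 0 t₁, φ0 1 t - φ0 0 t ≠ 0 →
    φ i ε t = φ0 i t + (φ0 1 t - φ0 0 t) * φ1 i ((φ0 1 t - φ0 0 t) / ε) t
  φ_smooth : ∀ i, ∀ ε ∈ Ioo 0 ε₀, ContDiffOn ℝ 1 (φ i ε) (Icc 0 t₁)
  /-- the velocities of the approximate fronts are bounded uniformly in `ε` -/
  φ_speed : ∃ M, ∀ i, ∀ ε ∈ Ioo 0 ε₀, ∀ t ∈ Icc 0 t₁,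
    |derivWithin (φ i ε) (Icc 0 t₁) t| ≤ M
  β_smooth : ContDiff ℝ 1 β
  δ₁_pos : 0 < δ₁
  β_bounds : ∀ τ, δ₁ < β τ ∧ β τ < δ₂
  β_deriv : ∃ M, ∀ τ, |deriv β τ| ≤ M
  β_top : (fun τ => β τ - 1) =O[atTop] fun τ : ℝ => τ⁻¹
  β_deriv_top : deriv β =O[atTop] fun τ : ℝ => τ⁻¹
  γp_smooth : ∀ i, ContDiffOn ℝ 1 (γp i) (Icc 0 t₁)
  γm_smooth : ∀ i, ContDiffOn ℝ 1 (γm i) (Icc 0 t₁)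
  B_smooth : ContDiff ℝ ∞ B
  B_top : Tendsto B atTop (𝓝 1)
  B_bot : Tendsto B atBot (𝓝 0)
  B_deriv : ∀ n : ℕ, 1 ≤ n → ∀ N : ℕ,
    iteratedDeriv n B =O[cocompact ℝ] fun ρ : ℝ => (|ρ| ^ N)⁻¹
  e_test : IsTest l₁ l₂ e
  e_one : ∀ ε ∈ Ioo 0 ε₀, ∀ t ∈ Icc 0 t₁, ∀ x ∈ uIcc (φ 0 ε t) (φ 1 ε t), e x = 1

namespace Ansatz

variable (A : Ansatz)

/-- Derivative in time on `[0, t₁]` (one-sided at the end points). -/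
def dt (f : ℝ → ℝ) (t : ℝ) : ℝ := derivWithin f (Icc 0 A.t₁) t

/-- `ψ₀ = φ_{20} - φ_{10}` -/
def ψ0 (t : ℝ) : ℝ := A.φ0 1 t - A.φ0 0 t

/-- `τ = ψ₀ / ε` -/
def τ (ε t : ℝ) : ℝ := A.ψ0 t / ε

/-- `ψ = φ_2 - φ_1` -/
def ψ (ε t : ℝ) : ℝ := A.φ 1 ε t - A.φ 0 ε t

/-- `ρ = ψ / ε` -/
def ρ (ε t : ℝ) : ℝ := A.ψ ε t / ε

/-- `η = ρ β` -/
def η (ε t : ℝ) : ℝ := A.ρ ε t * A.β (A.τ ε t)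

/-- the midpoint `x^* = (φ_1 + φ_2) / 2` -/
def xs (ε t : ℝ) : ℝ := (A.φ 0 ε t + A.φ 1 ε t) / 2

/-- The ansatz `ǔ` of the order function, with `ω₀ = tanh`. -/
def u (ε x t : ℝ) : ℝ :=
  let a := Real.tanh (A.β (A.τ ε t) * ((A.φ 0 ε t - x) / ε))
  let b := Real.tanh (A.β (A.τ ε t) * ((x - A.φ 1 ε t) / ε))
  1 / 2 * (1 + a + b - a * b)

/-- `γ^-`: the linear function of `x` equal to `γ_1^+` at `φ_1` and to `γ_2^-` at `φ_2`. -/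
def γMinus (ε x t : ℝ) : ℝ :=
  (A.γp 0 t + A.γm 1 t) / 2 - (x - A.xs ε t) * (A.γp 0 t - A.γm 1 t) / A.ψ ε t

/-- `γ̂`: the linear function of `x` equal to `γ̂_1 = γ_1^-` at `φ_1` and to `γ̂_2 = γ_2^+`
at `φ_2`. -/
def γHat (ε x t : ℝ) : ℝ :=
  (A.γm 0 t + A.γp 1 t) / 2 - (x - A.xs ε t) * (A.γm 0 t - A.γp 1 t) / A.ψ ε t

/-- `(φ_1 - x)(x - φ_2) / ψ` -/
def P (ε x t : ℝ) : ℝ := (A.φ 0 ε t - x) * (x - A.φ 1 ε t) / A.ψ ε t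

/-- `I`: the linear function of `x` equal to `(-1)^{i+1} φ_{it}` at `φ_i`. -/
def I (ε x t : ℝ) : ℝ :=
  (A.dt (A.φ 0 ε) t - A.dt (A.φ 1 ε) t) / 2
    - (x - A.xs ε t) * (A.dt (A.φ 0 ε) t + A.dt (A.φ 1 ε) t) / A.ψ ε t

/-- `H(x - φ_1) - H(x - φ_2)` -/
def D (ε x t : ℝ) : ℝ := heaviside (x - A.φ 0 ε t) - heaviside (x - A.φ 1 ε t)

/-- The part `Ť - I` of the temperature model, which has kinks at the fronts. -/
def K (ε x t : ℝ) : ℝ :=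
  A.γm 0 t * (A.φ 0 ε t - x) * heaviside (A.φ 0 ε t - x)
    + A.γp 1 t * (x - A.φ 1 ε t) * heaviside (x - A.φ 1 ε t)
    + A.γMinus ε x t * A.P ε x t * A.B (A.τ ε t) * A.D ε x t
    + A.γHat ε x t * A.P ε x t * (1 - A.B (A.τ ε t)) * -A.D ε x t

/-- The temperature model `Ť`. -/
def T (ε x t : ℝ) : ℝ := A.K ε x t + A.I ε x t

/-- The global temperature `θ̌ = e Ť + q̌ + q̂`. -/
def θ (qc qh : ℝ → ℝ → ℝ → ℝ) (ε x t : ℝ) : ℝ :=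
  A.e x * A.T ε x t + qc ε x t + qh ε x t

/-- `B_{0̇0}` as a function of `η` -/
def B00 (η : ℝ) : ℝ := ∫ z, deriv Real.tanh z * Real.tanh (-η - z)

/-- `B^z_{0̇0}` as a function of `η` -/
def Bz00 (η : ℝ) : ℝ := ∫ z, z * deriv Real.tanh z * Real.tanh (-η - z)

/-- `A_i`: the coefficients of `δ(x - φ_i)` in the weak asymptotics of `∂ǔ/∂t`. -/
def coefA (i : Fin 2) (ε t : ℝ) : ℝ :=
  (-1) ^ (i : ℕ) * (A.dt (A.φ i ε) t / 2) * (2 - B00 (A.η ε t))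
    - deriv A.β (A.τ ε t) * A.dt A.ψ0 t / (2 * A.β (A.τ ε t) ^ 2) * Bz00 (A.η ε t)

/-- The condition on the `δ`-coefficients:
`∑ i, (B [γ_i^+ + γ_i^-] - A_i) δ(x - φ_i) = O_{D'}(ε)`. -/
def DeltaCondition (J : Set ℝ) : Prop :=
  IsODistr A.l₁ A.l₂ A.ε₀ J fun ε t ζ =>
    ∑ i : Fin 2, (A.B (A.τ ε t) * (A.γp i t + A.γm i t) - A.coefA i ε t) * ζ (A.φ i ε t)

/-- The term `F` of the heat equation for `q`: the pointwise value of
`-e ∂_t(Ť - I) + 2 e' ∂_x(Ť - I) + e'' (Ť - I)` off the fronts. -/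
def F (ε x t : ℝ) : ℝ :=
  -(A.e x * A.dt (fun s => A.K ε x s) t)
    + 2 * deriv A.e x * deriv (fun y => A.K ε y t) x
    + iteratedDeriv 2 A.e x * A.K ε x t

/-- The terms of the heat equation for `q` that are singular as `ψ → 0`, applied to `ζ`:
`∂_x²(γ^- P) B [H(x-φ_1) - H(x-φ_2)] + ∂_x²(γ̂ P) (1-B) [H(x-φ_2) - H(x-φ_1)]`.
At instants where `ψ = 0` this is understood as the limit `ψ → 0`, a multiple of the Dirac
function. -/
def singular (ε t : ℝ) (ζ : ℝ → ℝ) : ℝ :=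
  open scoped Classical in
  if A.ψ ε t = 0 then
    (-(A.γp 0 t + A.γm 1 t) * A.B (A.τ ε t)
      + (A.γm 0 t + A.γp 1 t) * (1 - A.B (A.τ ε t))) * ζ (A.φ 0 ε t)
  else
    ∫ x in Ioo A.l₁ A.l₂,
      (iteratedDeriv 2 (fun y => A.γMinus ε y t * A.P ε y t) x * A.B (A.τ ε t) * A.D ε x t
        + iteratedDeriv 2 (fun y => A.γHat ε y t * A.P ε y t) x * (1 - A.B (A.τ ε t))
          * -A.D ε x t) * ζ x

/-- The unknown `q + e I`, `q = q̌ + q̂`, of the heat equation for `q`. -/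
def w (qc qh : ℝ → ℝ → ℝ → ℝ) (ε x t : ℝ) : ℝ :=
  qc ε x t + qh ε x t + A.e x * A.I ε x t

/-- `q̂` has zero initial and boundary data, and `w = q̌ + q̂ + e I` is continuous,
differentiable in `x` and in `t` off the fronts, and solves, at every time of `J` and in the
sense of distributions in `x`, the heat equation
`L w = F + ∂_x²(γ^- P) B [H(x-φ_1) - H(x-φ_2)] + ∂_x²(γ̂ P) (1-B) [H(x-φ_2) - H(x-φ_1)]`. -/
structure SolvesHeat (J : Set ℝ) (qc qh : ℝ → ℝ → ℝ → ℝ) : Prop where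
  initial : ∀ ε ∈ Ioo 0 A.ε₀, ∀ x ∈ Icc A.l₁ A.l₂, qh ε x 0 = 0
  /-- zero Dirichlet or zero Neumann data at each of the end points -/
  boundary : ∀ l ∈ ({A.l₁, A.l₂} : Set ℝ),
    (∀ ε ∈ Ioo 0 A.ε₀, ∀ t ∈ Icc 0 A.t₁, qh ε l t = 0) ∨
    (∀ ε ∈ Ioo 0 A.ε₀, ∀ t ∈ Icc 0 A.t₁,
      HasDerivWithinAt (fun x => qh ε x t) 0 (Icc A.l₁ A.l₂) l)
  cont : ∀ ε ∈ Ioo 0 A.ε₀,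
    ContinuousOn (fun p : ℝ × ℝ => A.w qc qh ε p.1 p.2) (Icc A.l₁ A.l₂ ×ˢ Icc 0 A.t₁)
  diff : ∀ ε ∈ Ioo 0 A.ε₀, ∀ t ∈ J, ∀ x ∈ Ioo A.l₁ A.l₂,
    x ≠ A.φ 0 ε t → x ≠ A.φ 1 ε t →
      DifferentiableAt ℝ (fun y => A.w qc qh ε y t) x ∧
      DifferentiableWithinAt ℝ (fun s => A.w qc qh ε x s) (Icc 0 A.t₁) t
  int_t : ∀ ε ∈ Ioo 0 A.ε₀, ∀ t ∈ J,
    LocallyIntegrableOn (fun x => A.dt (fun s => A.w qc qh ε x s) t) (Ioo A.l₁ A.l₂)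
  int_x : ∀ ε ∈ Ioo 0 A.ε₀, ∀ t ∈ J,
    LocallyIntegrableOn (fun x => deriv (fun y => A.w qc qh ε y t) x) (Ioo A.l₁ A.l₂)
  eqn : ∀ ε ∈ Ioo 0 A.ε₀, ∀ t ∈ J, ∀ ζ, IsTest A.l₁ A.l₂ ζ →
    (∫ x in Ioo A.l₁ A.l₂, A.dt (fun s => A.w qc qh ε x s) t * ζ x)
      + (∫ x in Ioo A.l₁ A.l₂, deriv (fun y => A.w qc qh ε y t) x * deriv ζ x)
    = (∫ x in Ioo A.l₁ A.l₂, A.F ε x t * ζ x) + A.singular ε t ζ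

end Ansatz

/-- The heat equation of the phase field system holds for the pair `(u, θ)` up to `O(ε)` in
the weak sense, uniformly for `t ∈ J`:
`∫ (u_t + θ_t) ζ dx + ∫ θ_x ζ_x dx = O(ε)` for every test function `ζ`.
Here `u`, `θ` are continuous in `(x, t)`, the derivatives exist except at finitely many `x` for
each `t`, and the integrals converge. -/
structure HeatRelation (l₁ l₂ t₁ ε₀ : ℝ) (J : Set ℝ) (u θ : ℝ → ℝ → ℝ → ℝ) : Prop where
  cont_u : ∀ ε ∈ Ioo 0 ε₀,
    ContinuousOn (fun p : ℝ × ℝ => u ε p.1 p.2) (Icc l₁ l₂ ×ˢ Icc 0 t₁)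
  cont_θ : ∀ ε ∈ Ioo 0 ε₀,
    ContinuousOn (fun p : ℝ × ℝ => θ ε p.1 p.2) (Icc l₁ l₂ ×ˢ Icc 0 t₁)
  diff : ∀ ε ∈ Ioo 0 ε₀, ∀ t ∈ J, ∃ S : Finset ℝ, ∀ x ∈ Ioo l₁ l₂, x ∉ S →
    DifferentiableWithinAt ℝ (fun s => u ε x s) (Icc 0 t₁) t ∧
    DifferentiableWithinAt ℝ (fun s => θ ε x s) (Icc 0 t₁) t ∧
    DifferentiableAt ℝ (fun y => θ ε y t) x
  int_t : ∀ ε ∈ Ioo 0 ε₀, ∀ t ∈ J,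
    LocallyIntegrableOn (fun x => derivWithin (fun s => u ε x s) (Icc 0 t₁) t
      + derivWithin (fun s => θ ε x s) (Icc 0 t₁) t) (Ioo l₁ l₂)
  int_x : ∀ ε ∈ Ioo 0 ε₀, ∀ t ∈ J,
    LocallyIntegrableOn (fun x => deriv (fun y => θ ε y t) x) (Ioo l₁ l₂)
  estimate : IsODistr l₁ l₂ ε₀ J fun ε t ζ =>
    (∫ x in Ioo l₁ l₂, (derivWithin (fun s => u ε x s) (Icc 0 t₁) t
      + derivWithin (fun s => θ ε x s) (Icc 0 t₁) t) * ζ x)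
    + ∫ x in Ioo l₁ l₂, deriv (fun y => θ ε y t) x * deriv ζ x

end PhaseField

end

/-! Split `θ = e K + w`, so that the equation assumed for `w` can be inserted into the weak form.
The term `-e K_t` of `F` cancels the contribution of `e K_t`, and what remains of `K` is the
distribution `∂_x²(e K) - 2 e' ∂_x K - e'' K = e ∂_x² K` with the sign changed. Since `K` is
continuous and only has kinks at the fronts, `∂_x² K` consists of a regular part between the fronts,
which the singular source cancels, and of slope jumps. The parabola `P` vanishes at both fronts with
slopes `±1`, so the jump of slope at the `i`-th front is exactly `B (γ_i^+ + γ_i^-)`. Hence the weak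
form equals, with no error, `∫ u_t ζ - ∑ B (γ_i^+ + γ_i^-) ζ(φ_i)` (`heatRelation_lhs_eq`, resting
on `integral_cutoff_K` and `integral_cutoff_jumpFun`).

The order `ε` enters only through `u_t`. By the product rule it is `(1/2) (a_t (1 - b) + b_t (1 -
a))`, a sum of two profiles of width `ε / β`. Freezing `ζ` at the front gives the coefficients `A_i`
exactly, because `B00` and `Bz00` are the moments that occur. The Lipschitz error is `O(ε)`,
uniformly in `η` and `t`, since `1 - tanh ≤ 2` and `β` is bounded below (`u_weak_asymptotics`). The
condition on the `δ`-coefficients then closes the estimate.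

At the confluence `ψ = 0` the inner part of `K` disappears, and the Dirac mass in `singular`
supplies the missing part of the slope jump. -/

namespace PhaseField

/-! ### Moments of `tanh'` and averaging over a front. -/

section Tanh

theorem hasDerivAt_tanh (z : ℝ) : HasDerivAt Real.tanh (1 / Real.cosh z ^ 2) z := by
  have h := (Real.hasDerivAt_sinh z).div (Real.hasDerivAt_cosh z) (Real.cosh_pos z).ne'
  have e : Real.tanh = Real.sinh / Real.cosh := by
    funext y; exact Real.tanh_eq_sinh_div_cosh y
  rw [e]
  refine h.congr_deriv ?_
  rw [← Real.cosh_sq_sub_sinh_sq z]; ring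

theorem deriv_tanh (z : ℝ) : deriv Real.tanh z = 1 / Real.cosh z ^ 2 := (hasDerivAt_tanh z).deriv

@[fun_prop]
theorem differentiable_tanh : Differentiable ℝ Real.tanh :=
  fun z => (hasDerivAt_tanh z).differentiableAt

@[fun_prop]
theorem continuous_tanh : Continuous Real.tanh := differentiable_tanh.continuous

@[fun_prop]
theorem continuous_deriv_tanh : Continuous (deriv Real.tanh) := by
  have : deriv Real.tanh = fun z => 1 / Real.cosh z ^ 2 := funext deriv_tanh
  rw [this]
  exact continuous_const.div (Real.continuous_cosh.pow 2) fun z => (pow_pos (Real.cosh_pos z) 2).ne'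

theorem deriv_tanh_nonneg (z : ℝ) : 0 ≤ deriv Real.tanh z := by
  rw [deriv_tanh]; positivity

theorem deriv_tanh_neg (z : ℝ) : deriv Real.tanh (-z) = deriv Real.tanh z := by
  simp [deriv_tanh]

theorem one_add_half_sq_le_cosh (z : ℝ) : 1 + z ^ 2 / 2 ≤ Real.cosh z := by
  have h : Real.cosh z = 1 + 2 * Real.sinh (z / 2) ^ 2 := by
    have := Real.cosh_two_mul (z / 2)
    rw [Real.cosh_sq, mul_div_cancel₀ z two_ne_zero] at this
    linarith
  have h2 : (z / 2) ^ 2 ≤ Real.sinh (z / 2) ^ 2 := by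
    rw [sq_le_sq, Real.abs_sinh]
    exact Real.self_le_sinh_iff.2 (abs_nonneg _)
  rw [h]; nlinarith

/-- Quadratic growth of `cosh` already gives `tanh'` decay of order `z⁻⁴`. That is all the later
integrals need, as their weights grow at most quadratically. -/
theorem one_add_sq_mul_deriv_tanh_le (z : ℝ) :
    (1 + z ^ 2) * deriv Real.tanh z ≤ 4 * (1 + z ^ 2)⁻¹ := by
  have h := one_add_half_sq_le_cosh z
  have hc : (1 + z ^ 2) ^ 2 ≤ 4 * Real.cosh z ^ 2 := by nlinarith [sq_nonneg z]
  have hp : 0 < Real.cosh z ^ 2 := pow_pos (Real.cosh_pos z) 2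
  rw [deriv_tanh, mul_one_div, ← div_eq_mul_inv, div_le_div_iff₀ hp (by positivity)]
  nlinarith

theorem integrable_one_add_sq_mul_deriv_tanh :
    Integrable fun z : ℝ => (1 + z ^ 2) * deriv Real.tanh z := by
  refine (integrable_inv_one_add_sq.const_mul 4).mono'
    (by fun_prop : Continuous _).aestronglyMeasurable (ae_of_all _ fun z => ?_)
  rw [Real.norm_eq_abs, abs_of_nonneg (mul_nonneg (by positivity) (deriv_tanh_nonneg z))]
  exact one_add_sq_mul_deriv_tanh_le z

/-- Continuous functions of at most quadratic growth are integrable against `tanh'`. -/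
theorem integrable_deriv_tanh_mul {g : ℝ → ℝ} (hg : Continuous g) {C : ℝ}
    (hb : ∀ z, |g z| ≤ C * (1 + z ^ 2)) : Integrable fun z => deriv Real.tanh z * g z := by
  refine (integrable_one_add_sq_mul_deriv_tanh.const_mul C).mono'
    (by fun_prop : Continuous _).aestronglyMeasurable (ae_of_all _ fun z => ?_)
  rw [Real.norm_eq_abs, abs_mul, abs_of_nonneg (deriv_tanh_nonneg z)]
  nlinarith [hb z, deriv_tanh_nonneg z, mul_le_mul_of_nonneg_left (hb z) (deriv_tanh_nonneg z)]

theorem abs_le_one_add_sq (z : ℝ) : |z| ≤ 1 + z ^ 2 := by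
  nlinarith [sq_nonneg (|z| - 1), sq_abs z, abs_nonneg z]

theorem tendsto_tanh_atTop : Tendsto Real.tanh atTop (𝓝 1) := by
  have e : ∀ x, Real.tanh x = 1 - 2 / (Real.exp (2 * x) + 1) := fun x => by
    have h1 : Real.exp (2 * x) = Real.exp x * Real.exp x := by rw [← Real.exp_add]; ring_nf
    rw [Real.tanh_eq, Real.exp_neg, h1]
    have := Real.exp_pos x
    field_simp
    ring
  have h : Tendsto (fun x : ℝ => Real.exp (2 * x) + 1) atTop atTop :=
    tendsto_atTop_add_const_right _ _
      (Real.tendsto_exp_atTop.comp (tendsto_id.const_mul_atTop two_pos))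
  have h2 := (tendsto_const_nhds (x := (1 : ℝ))).sub
    ((tendsto_const_nhds (x := (2 : ℝ))).div_atTop h)
  rw [sub_zero] at h2
  exact h2.congr fun x => (e x).symm

theorem tendsto_tanh_atBot : Tendsto Real.tanh atBot (𝓝 (-1)) := by
  have h := (tendsto_tanh_atTop.comp tendsto_neg_atBot_atTop).neg
  exact h.congr fun x => by simp

theorem integrable_deriv_tanh : Integrable (deriv Real.tanh) := by
  simpa using integrable_deriv_tanh_mul (g := fun _ => 1) continuous_const (C := 1)
    (fun z => by simp; positivity)

theorem integral_deriv_tanh : ∫ z, deriv Real.tanh z = 2 := by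
  rw [integral_of_hasDerivAt_of_tendsto (fun z => (differentiable_tanh z).hasDerivAt)
    integrable_deriv_tanh tendsto_tanh_atBot tendsto_tanh_atTop]
  norm_num

theorem integral_mul_deriv_tanh : ∫ z, z * deriv Real.tanh z = 0 := by
  have h := integral_neg_eq_self (fun z => z * deriv Real.tanh z) volume
  simp only [deriv_tanh_neg, neg_mul, integral_neg] at h
  linarith

/-- The mass of `tanh'` is `2` and its first moment vanishes by parity; the remaining two integrals
are `B00` and `Bz00` by definition. -/
theorem integral_affine_deriv_tanh (η c d : ℝ) :
    ∫ z, deriv Real.tanh z * ((c + d * z) * (1 - Real.tanh (-η - z)))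
      = c * (2 - Ansatz.B00 η) - d * Ansatz.Bz00 η := by
  have i0 := integrable_deriv_tanh
  have i1 : Integrable fun z => z * deriv Real.tanh z := by
    simpa [mul_comm] using integrable_deriv_tanh_mul (g := fun z => z) continuous_id (C := 1)
      (fun z => by simpa using abs_le_one_add_sq z)
  have i2 : Integrable fun z => deriv Real.tanh z * Real.tanh (-η - z) :=
    integrable_deriv_tanh_mul (by fun_prop) (C := 1) fun z =>
      (Real.abs_tanh_lt_one _).le.trans (by nlinarith [sq_nonneg z])
  have i3 : Integrable fun z => z * deriv Real.tanh z * Real.tanh (-η - z) := by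
    have := integrable_deriv_tanh_mul (g := fun z => z * Real.tanh (-η - z)) (by fun_prop) (C := 1)
      fun z => by
        rw [abs_mul, one_mul]
        exact (mul_le_of_le_one_right (abs_nonneg _) (Real.abs_tanh_lt_one _).le).trans
          (abs_le_one_add_sq z)
    exact this.congr (ae_of_all _ fun z => by ring)
  have e : ∀ z, deriv Real.tanh z * ((c + d * z) * (1 - Real.tanh (-η - z)))
      = (c * deriv Real.tanh z - c * (deriv Real.tanh z * Real.tanh (-η - z)))
        + (d * (z * deriv Real.tanh z) - d * (z * deriv Real.tanh z * Real.tanh (-η - z))) :=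
    fun z => by ring
  simp_rw [e]
  have j0 : Integrable fun z =>
      c * deriv Real.tanh z - c * (deriv Real.tanh z * Real.tanh (-η - z)) :=
    (i0.const_mul c).sub (i2.const_mul c)
  have j1 : Integrable fun z =>
      d * (z * deriv Real.tanh z) - d * (z * deriv Real.tanh z * Real.tanh (-η - z)) :=
    (i1.const_mul d).sub (i3.const_mul d)
  rw [integral_add j0 j1,
    integral_sub (i0.const_mul c) (i2.const_mul c), integral_sub (i1.const_mul d) (i3.const_mul d)]
  simp only [integral_const_mul, integral_deriv_tanh, integral_mul_deriv_tanh]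
  rw [Ansatz.B00, Ansatz.Bz00]
  ring

/-- Averaging a Lipschitz function over a front of width `k`. -/
theorem abs_integral_front_sub_le {ζ : ℝ → ℝ} (hζ : Continuous ζ) {L : ℝ}
    (hL : ∀ x y, |ζ x - ζ y| ≤ L * |x - y|) (η c d p k : ℝ) :
    |(∫ z, deriv Real.tanh z * ((c + d * z) * (1 - Real.tanh (-η - z)) * ζ (p + k * z)))
        - ζ p * (c * (2 - Ansatz.B00 η) - d * Ansatz.Bz00 η)|
      ≤ 2 * (|c| + |d|) * L * |k| * ∫ z, (1 + z ^ 2) * deriv Real.tanh z := by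
  -- Two points at distance one force the Lipschitz constant to be nonnegative.
  have hL0 : 0 ≤ L := by simpa using (abs_nonneg _).trans (hL 1 0)
  have hlin : ∀ z, |c + d * z| ≤ |c| + |d| * |z| := fun z => by
    simpa [abs_mul] using abs_add_le c (d * z)
  have ht : ∀ z, |1 - Real.tanh (-η - z)| ≤ 2 := fun z => by
    have := abs_lt.1 (Real.abs_tanh_lt_one (-η - z))
    rw [abs_le]; constructor <;> linarith [this.1, this.2]
  have i0 : Integrable fun z => deriv Real.tanh z * ((c + d * z) * (1 - Real.tanh (-η - z))) := by
    refine integrable_deriv_tanh_mul (by fun_prop) (C := (|c| + |d|) * 2) fun z => ?_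
    rw [abs_mul]
    calc _ ≤ (|c| + |d| * |z|) * 2 := mul_le_mul (hlin z) (ht z) (abs_nonneg _) (by positivity)
      _ ≤ ((|c| + |d|) * (1 + z ^ 2)) * 2 := by
        have := mul_le_mul_of_nonneg_left (abs_le_one_add_sq z) (abs_nonneg d)
        nlinarith [abs_nonneg c, sq_nonneg z, mul_nonneg (abs_nonneg c) (sq_nonneg z)]
      _ = _ := by ring
  have hb : ∀ z, |(c + d * z) * (1 - Real.tanh (-η - z)) * (ζ (p + k * z) - ζ p)|
      ≤ 2 * (|c| + |d|) * L * |k| * (1 + z ^ 2) := fun z => by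
    have h3 : |ζ (p + k * z) - ζ p| ≤ L * (|k| * |z|) := by
      simpa [abs_mul] using hL (p + k * z) p
    rw [abs_mul, abs_mul]
    calc _ ≤ (|c| + |d| * |z|) * 2 * (L * (|k| * |z|)) := by
          gcongr
          · exact hlin z
          · exact ht z
      _ = 2 * (L * |k|) * (|c| * |z| + |d| * z ^ 2) := by rw [← sq_abs z]; ring
      _ ≤ 2 * (L * |k|) * (|c| * (1 + z ^ 2) + |d| * (1 + z ^ 2)) := by
          gcongr
          · exact abs_le_one_add_sq z
          · linarith
      _ = _ := by ring
  have i1 : Integrable fun z => deriv Real.tanh z *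
      ((c + d * z) * (1 - Real.tanh (-η - z)) * (ζ (p + k * z) - ζ p)) :=
    integrable_deriv_tanh_mul (by fun_prop) hb
  -- Subtracting the value with `ζ` frozen at `p` leaves the increment `ζ (p + k z) - ζ p`, which
  -- costs a factor `|k| |z|`.
  have e : (∫ z, deriv Real.tanh z * ((c + d * z) * (1 - Real.tanh (-η - z)) * ζ (p + k * z)))
        - ζ p * (c * (2 - Ansatz.B00 η) - d * Ansatz.Bz00 η)
      = ∫ z, deriv Real.tanh z *
      ((c + d * z) * (1 - Real.tanh (-η - z)) * (ζ (p + k * z) - ζ p)) := by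
    rw [← integral_affine_deriv_tanh, ← integral_const_mul, sub_eq_iff_eq_add,
      ← integral_add i1 (i0.const_mul _)]
    exact integral_congr_ae (ae_of_all _ fun z => by ring)
  rw [e, ← integral_const_mul, ← Real.norm_eq_abs]
  refine norm_integral_le_of_norm_le (integrable_one_add_sq_mul_deriv_tanh.const_mul _)
    (ae_of_all _ fun z => ?_)
  rw [Real.norm_eq_abs, abs_mul, abs_of_nonneg (deriv_tanh_nonneg z)]
  nlinarith [mul_le_mul_of_nonneg_left (hb z) (deriv_tanh_nonneg z)]

end Tanh


/-- A profile of width `|k|` concentrated at `p`. -/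
noncomputable def frontProfile (η c d p k x : ℝ) : ℝ :=
  deriv Real.tanh ((x - p) / k) *
    ((c + d * ((x - p) / k)) * (1 - Real.tanh (-η - (x - p) / k))) / (2 * |k|)

@[fun_prop]
theorem continuous_frontProfile (η c d p k : ℝ) : Continuous (frontProfile η c d p k) := by
  unfold frontProfile
  exact Continuous.div_const (by fun_prop) _

/-- Negative `k` is needed: the scaled variable of the left front decreases in `x`. -/
theorem integral_eq_abs_mul_integral_comp_affine (f : ℝ → ℝ) (p : ℝ) {k : ℝ} (hk : k ≠ 0) :
    ∫ x, f x = |k| * ∫ z, f (p + k * z) := by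
  rw [Measure.integral_comp_mul_left (fun y => f (p + y)) k, integral_add_left_eq_self f p,
    smul_eq_mul, ← mul_assoc, abs_inv, mul_inv_cancel₀ (abs_ne_zero.2 hk), one_mul]

theorem abs_integral_frontProfile_sub_le {ζ : ℝ → ℝ} (hζ : Continuous ζ) {L : ℝ}
    (hL : ∀ x y, |ζ x - ζ y| ≤ L * |x - y|) (η c d p : ℝ) {k : ℝ} (hk : k ≠ 0) :
    |(∫ x, frontProfile η c d p k x * ζ x)
        - (c / 2 * (2 - Ansatz.B00 η) - d / 2 * Ansatz.Bz00 η) * ζ p|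
      ≤ (|c| + |d|) * L * |k| * ∫ z, (1 + z ^ 2) * deriv Real.tanh z := by
  have hk' := abs_ne_zero.2 hk
  have e : ∫ x, frontProfile η c d p k x * ζ x
      = 1 / 2 * ∫ z, deriv Real.tanh z * ((c + d * z) * (1 - Real.tanh (-η - z)) * ζ (p + k * z)) := by
    rw [integral_eq_abs_mul_integral_comp_affine _ p hk, ← integral_const_mul, ← integral_const_mul]
    refine integral_congr_ae (ae_of_all _ fun z => ?_)
    have hz : (p + k * z - p) / k = z := by field_simp; ring
    simp only [frontProfile, hz]
    field_simp
  have h := abs_integral_front_sub_le hζ hL η c d p k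
  rw [e, show ∀ X : ℝ, 1 / 2 * X - (c / 2 * (2 - Ansatz.B00 η) - d / 2 * Ansatz.Bz00 η) * ζ p
    = 1 / 2 * (X - ζ p * (c * (2 - Ansatz.B00 η) - d * Ansatz.Bz00 η)) from fun X => by ring,
    abs_mul, abs_of_pos (by norm_num : (0 : ℝ) < 1 / 2)]
  linarith

/-! ### Test functions. -/

namespace IsTest

variable {l₁ l₂ : ℝ} {ζ : ℝ → ℝ}

theorem continuous (h : IsTest l₁ l₂ ζ) : Continuous ζ := h.smooth.continuous

theorem differentiable (h : IsTest l₁ l₂ ζ) : Differentiable ℝ ζ :=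
  h.smooth.differentiable (by simp)

theorem eq_zero (h : IsTest l₁ l₂ ζ) {x : ℝ} (hx : x ∉ Ioo l₁ l₂) : ζ x = 0 :=
  image_eq_zero_of_notMem_tsupport fun h' => hx (h.supp h')

theorem deriv (h : IsTest l₁ l₂ ζ) : IsTest l₁ l₂ (deriv ζ) where
  smooth := h.smooth.deriv' 
  compact := h.compact.deriv
  supp := (tsupport_deriv_subset (f := ζ)).trans h.supp

theorem mul_left {f : ℝ → ℝ} (hf : ContDiff ℝ ∞ f) (h : IsTest l₁ l₂ ζ) :
    IsTest l₁ l₂ (fun x => f x * ζ x) where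
  smooth := hf.mul h.smooth
  compact := h.compact.mul_left
  supp := (tsupport_mul_subset_right (f := f)).trans h.supp

theorem exists_lipschitz (h : IsTest l₁ l₂ ζ) : ∃ L : ℝ, ∀ x y, |ζ x - ζ y| ≤ L * |x - y| := by
  obtain ⟨C, hC⟩ := ContDiff.lipschitzWith_of_hasCompactSupport h.compact h.smooth (by simp)
  exact ⟨C, fun x y => by simpa [Real.dist_eq] using hC.dist_le_mul x y⟩

theorem setIntegral_eq (h : IsTest l₁ l₂ ζ) (f : ℝ → ℝ) :
    ∫ x in Ioo l₁ l₂, f x * ζ x = ∫ x, f x * ζ x :=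
  setIntegral_eq_integral_of_forall_compl_eq_zero fun x hx => by rw [h.eq_zero hx, mul_zero]

theorem integrable_mul (h : IsTest l₁ l₂ ζ) {f : ℝ → ℝ}
    (hf : LocallyIntegrableOn f (Ioo l₁ l₂)) : Integrable fun x => f x * ζ x := by
  have h1 : IntegrableOn f (tsupport ζ) := hf.integrableOn_compact_subset h.supp h.compact
  have h2 := h1.mul_continuousOn h.continuous.continuousOn h.compact
  refine (integrableOn_iff_integrable_of_support_subset ?_).1 h2
  exact (Function.support_mul_subset_right _ _).trans (subset_tsupport ζ)

end IsTest

/-! ### Weak asymptotics of the time derivative of the order function. -/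

namespace Ansatz

variable (A : Ansatz)

theorem t₁_pos : 0 < A.t₁ := A.ts_mem.1.trans A.ts_mem.2

theorem uniqueDiffOn : UniqueDiffOn ℝ (Icc 0 A.t₁) := uniqueDiffOn_Icc A.t₁_pos

variable {A} {ε t : ℝ}

theorem hasDerivWithinAt_dt {f : ℝ → ℝ} (hf : ContDiffOn ℝ 1 f (Icc 0 A.t₁))
    (ht : t ∈ Icc 0 A.t₁) : HasDerivWithinAt f (A.dt f t) (Icc 0 A.t₁) t :=
  (hf.differentiableOn (by simp) t ht).hasDerivWithinAt

theorem dt_eq {f : ℝ → ℝ} {f' : ℝ} (ht : t ∈ Icc 0 A.t₁)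
    (hf : HasDerivWithinAt f f' (Icc 0 A.t₁) t) : A.dt f t = f' :=
  hf.derivWithin (A.uniqueDiffOn t ht)

theorem φ_hasDeriv (i : Fin 2) (hε : ε ∈ Ioo 0 A.ε₀) (ht : t ∈ Icc 0 A.t₁) :
    HasDerivWithinAt (A.φ i ε) (A.dt (A.φ i ε) t) (Icc 0 A.t₁) t :=
  hasDerivWithinAt_dt (A.φ_smooth i ε hε) ht

variable (A) in
theorem ψ0_smooth : ContDiffOn ℝ 1 A.ψ0 (Icc 0 A.t₁) := (A.φ0_smooth 1).sub (A.φ0_smooth 0)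

theorem τ_hasDeriv (ht : t ∈ Icc 0 A.t₁) :
    HasDerivWithinAt (A.τ ε) (A.dt A.ψ0 t / ε) (Icc 0 A.t₁) t :=
  (hasDerivWithinAt_dt A.ψ0_smooth ht).div_const ε

theorem β_pos (τ : ℝ) : 0 < A.β τ := A.δ₁_pos.trans (A.β_bounds τ).1

theorem β_hasDeriv (ht : t ∈ Icc 0 A.t₁) :
    HasDerivWithinAt (fun s => A.β (A.τ ε s))
      (deriv A.β (A.τ ε t) * (A.dt A.ψ0 t / ε)) (Icc 0 A.t₁) t :=
  ((A.β_smooth.differentiable (by simp)) _).hasDerivAt.comp_hasDerivWithinAt t (τ_hasDeriv ht)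

/-- The arguments of the two `tanh` add up to `-η`. So in each term `a_t (1 - b)`, `b_t (1 - a)` the
second factor is `1 - tanh (-η - z)`, with `z` the scaled variable of the moving front. In `a_t` the
velocity gives the constant `c`, and the change of width, through `β'`, gives the part `d z`. -/
theorem u_hasDeriv (hε : ε ∈ Ioo 0 A.ε₀) (ht : t ∈ Icc 0 A.t₁) (x : ℝ) :
    HasDerivWithinAt (fun s => A.u ε x s)
      (frontProfile (A.η ε t) (A.dt (A.φ 0 ε) t)
          (deriv A.β (A.τ ε t) * A.dt A.ψ0 t / A.β (A.τ ε t) ^ 2)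
          (A.φ 0 ε t) (-(ε / A.β (A.τ ε t))) x
        + frontProfile (A.η ε t) (-A.dt (A.φ 1 ε) t)
          (deriv A.β (A.τ ε t) * A.dt A.ψ0 t / A.β (A.τ ε t) ^ 2)
          (A.φ 1 ε t) (ε / A.β (A.τ ε t)) x) (Icc 0 A.t₁) t := by
  have hb := β_pos (A := A) (A.τ ε t)
  have he : ε ≠ 0 := hε.1.ne'
  have hp : 0 < ε / A.β (A.τ ε t) := div_pos hε.1 hb
  have ha := (differentiable_tanh (A.β (A.τ ε t) * ((A.φ 0 ε t - x) / ε))).hasDerivAt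
    |>.comp_hasDerivWithinAt t ((β_hasDeriv (ε := ε) ht).mul (((φ_hasDeriv 0 hε ht).sub_const x).div_const ε))
  have hb' := (differentiable_tanh (A.β (A.τ ε t) * ((x - A.φ 1 ε t) / ε))).hasDerivAt
    |>.comp_hasDerivWithinAt t ((β_hasDeriv (ε := ε) ht).mul (((φ_hasDeriv 1 hε ht).const_sub x).div_const ε))
  have h := (((ha.const_add 1).add hb').sub (ha.mul hb')).const_mul (1 / 2)
  refine h.congr_deriv ?_
  have e0 : (x - A.φ 0 ε t) / -(ε / A.β (A.τ ε t)) = A.β (A.τ ε t) * ((A.φ 0 ε t - x) / ε) := by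
    field_simp; ring
  have e1 : (x - A.φ 1 ε t) / (ε / A.β (A.τ ε t)) = A.β (A.τ ε t) * ((x - A.φ 1 ε t) / ε) := by
    field_simp
  have e2 : -A.η ε t - A.β (A.τ ε t) * ((A.φ 0 ε t - x) / ε)
      = A.β (A.τ ε t) * ((x - A.φ 1 ε t) / ε) := by
    simp only [η, ρ, ψ]; ring
  have e3 : -A.η ε t - A.β (A.τ ε t) * ((x - A.φ 1 ε t) / ε)
      = A.β (A.τ ε t) * ((A.φ 0 ε t - x) / ε) := by
    simp only [η, ρ, ψ]; ring
  simp only [frontProfile, e0, e1, e2, e3, abs_neg, abs_of_pos hp, Function.comp_def, Pi.mul_apply]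
  field_simp
  ring

/-- `∂ǔ/∂t = ∑ i, A_i δ(x - φ_i) + O_{D'}(ε)`, uniformly in `t`. -/
theorem u_weak_asymptotics {ζ : ℝ → ℝ} (hζ : IsTest A.l₁ A.l₂ ζ) :
    ∃ C : ℝ, ∀ ε ∈ Ioo 0 A.ε₀, ∀ t ∈ Icc 0 A.t₁,
      |(∫ x, A.dt (fun s => A.u ε x s) t * ζ x) - ∑ i : Fin 2, A.coefA i ε t * ζ (A.φ i ε t)|
        ≤ C * ε := by
  obtain ⟨L, hL⟩ := hζ.exists_lipschitz
  obtain ⟨M, hM⟩ := A.φ_speed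
  obtain ⟨N, hN⟩ := A.β_deriv
  obtain ⟨R, hR⟩ : ∃ R, ∀ t ∈ Icc 0 A.t₁, |A.dt A.ψ0 t| ≤ R :=
    isCompact_Icc.exists_bound_of_continuousOn
      (A.ψ0_smooth.continuousOn_derivWithin A.uniqueDiffOn (by simp))
  set W := ∫ z, (1 + z ^ 2) * deriv Real.tanh z
  have hW : 0 ≤ W := integral_nonneg fun z => mul_nonneg (by positivity) (deriv_tanh_nonneg z)
  have hL0 : 0 ≤ L := by simpa using (abs_nonneg _).trans (hL 1 0)
  have hN0 : 0 ≤ N := (abs_nonneg _).trans (hN 0)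
  have hδ := A.δ₁_pos
  -- One summand per front: `M` bounds `c`, `N R / δ₁²` bounds `d`, and `ε / δ₁` bounds the width.
  refine ⟨2 * ((M + N * R / A.δ₁ ^ 2) * L * (1 / A.δ₁) * W), fun ε hε t ht => ?_⟩
  have hb := β_pos (A := A) (A.τ ε t)
  have hb1 := (A.β_bounds (A.τ ε t)).1.le
  have hk : 0 < ε / A.β (A.τ ε t) := div_pos hε.1 hb
  have hk1 : ε / A.β (A.τ ε t) ≤ 1 / A.δ₁ * ε := by
    rw [one_div_mul_eq_div]; exact div_le_div_of_nonneg_left hε.1.le hδ hb1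
  have hR0 : 0 ≤ R := (abs_nonneg _).trans (hR t ht)
  set d := deriv A.β (A.τ ε t) * A.dt A.ψ0 t / A.β (A.τ ε t) ^ 2 with hd
  have hdb : |d| ≤ N * R / A.δ₁ ^ 2 := by
    rw [hd, abs_div, abs_mul, abs_of_pos (pow_pos hb 2)]
    gcongr
    · exact hN _
    · exact hR t ht
  have key : ∀ c p k, |c| ≤ M → |k| = ε / A.β (A.τ ε t) →
      |(∫ x, frontProfile (A.η ε t) c d p k x * ζ x)
        - (c / 2 * (2 - B00 (A.η ε t)) - d / 2 * Bz00 (A.η ε t)) * ζ p|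
      ≤ (M + N * R / A.δ₁ ^ 2) * L * (1 / A.δ₁) * W * ε := fun c p k hc hkk => by
    refine (abs_integral_frontProfile_sub_le hζ.continuous hL _ c d p
      (abs_pos.1 (hkk ▸ hk))).trans ?_
    have hM0 : 0 ≤ M := (abs_nonneg _).trans hc
    rw [hkk]
    calc _ ≤ (M + N * R / A.δ₁ ^ 2) * L * (1 / A.δ₁ * ε) * W := by gcongr
      _ = _ := by ring
  have int : ∀ c p k, Integrable fun x => frontProfile (A.η ε t) c d p k x * ζ x := fun c p k =>
    hζ.integrable_mul ((continuous_frontProfile _ c d p k).locallyIntegrable.locallyIntegrableOn _)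
  have h0 := key (A.dt (A.φ 0 ε) t) (A.φ 0 ε t) (-(ε / A.β (A.τ ε t))) (hM 0 ε hε t ht)
    (by rw [abs_neg, abs_of_pos hk])
  have h1 := key (-A.dt (A.φ 1 ε) t) (A.φ 1 ε t) (ε / A.β (A.τ ε t))
    (by rw [abs_neg]; exact hM 1 ε hε t ht) (abs_of_pos hk)
  have e : (∫ x, A.dt (fun s => A.u ε x s) t * ζ x)
      = (∫ x, frontProfile (A.η ε t) (A.dt (A.φ 0 ε) t) d (A.φ 0 ε t)
            (-(ε / A.β (A.τ ε t))) x * ζ x)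
        + ∫ x, frontProfile (A.η ε t) (-A.dt (A.φ 1 ε) t) d (A.φ 1 ε t)
            (ε / A.β (A.τ ε t)) x * ζ x := by
    rw [← integral_add (int _ _ _) (int _ _ _)]
    refine integral_congr_ae (ae_of_all _ fun x => ?_)
    simp only [dt_eq ht (u_hasDeriv hε ht x), add_mul, hd]
  have e2 : ∑ i : Fin 2, A.coefA i ε t * ζ (A.φ i ε t)
      = (A.dt (A.φ 0 ε) t / 2 * (2 - B00 (A.η ε t)) - d / 2 * Bz00 (A.η ε t)) * ζ (A.φ 0 ε t)
        + (-A.dt (A.φ 1 ε) t / 2 * (2 - B00 (A.η ε t)) - d / 2 * Bz00 (A.η ε t))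
          * ζ (A.φ 1 ε t) := by
    simp only [Fin.sum_univ_two, coefA, hd]
    simp only [Fin.val_zero, Fin.val_one, pow_zero, pow_one]
    field_simp
  rw [e, e2, add_sub_add_comm]
  refine (abs_add_le _ _).trans ?_
  linarith

end Ansatz


/-! ### Distributional calculus of functions with two jumps. -/

theorem heaviside_of_nonneg {z : ℝ} (h : 0 ≤ z) : heaviside z = 1 := if_pos h

theorem heaviside_of_neg {z : ℝ} (h : z < 0) : heaviside z = 0 := if_neg h.not_ge

theorem monotone_heaviside : Monotone heaviside := fun x y h => by
  rcases lt_or_ge x 0 with hx | hx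
  · rw [heaviside_of_neg hx]; unfold heaviside; split_ifs <;> norm_num
  · rw [heaviside_of_nonneg hx, heaviside_of_nonneg (hx.trans h)]

theorem locallyIntegrable_heaviside (p : ℝ) : LocallyIntegrable fun x => heaviside (x - p) :=
  (monotone_heaviside.comp fun _ _ h => sub_le_sub_right h p).locallyIntegrable

theorem heaviside_eventuallyEq {z : ℝ} (h : z ≠ 0) : heaviside =ᶠ[𝓝 z] fun _ => heaviside z := by
  rcases h.lt_or_gt with h | h
  · filter_upwards [gt_mem_nhds h] with y hy
    rw [heaviside_of_neg h, heaviside_of_neg hy]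
  · filter_upwards [lt_mem_nhds h] with y hy
    rw [heaviside_of_nonneg h.le, heaviside_of_nonneg (le_of_lt hy)]

theorem integral_mul_heaviside (f : ℝ → ℝ) (p : ℝ) :
    ∫ x, f x * heaviside (x - p) = ∫ x in Ioi p, f x := by
  rw [← integral_Ici_eq_integral_Ioi, ← integral_indicator measurableSet_Ici]
  refine integral_congr_ae (ae_of_all _ fun x => ?_)
  by_cases h : p ≤ x
  · simp [indicator_of_mem (mem_Ici.2 h), heaviside_of_nonneg (sub_nonneg.2 h)]
  · simp [h, heaviside_of_neg (sub_neg.2 (not_le.1 h))]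

/-- A function with jumps at `p` and `q`. -/
noncomputable def jumpFun (p q : ℝ) (f₀ f₁ f₂ : ℝ → ℝ) (x : ℝ) : ℝ :=
  f₀ x + f₁ x * heaviside (x - p) + f₂ x * heaviside (x - q)

theorem locallyIntegrable_jumpFun {p q : ℝ} {f₀ f₁ f₂ : ℝ → ℝ} (h₀ : Continuous f₀)
    (h₁ : Continuous f₁) (h₂ : Continuous f₂) : LocallyIntegrable (jumpFun p q f₀ f₁ f₂) :=
  (h₀.locallyIntegrable.add ((locallyIntegrable_heaviside p).continuous_mul h₁)).add
    ((locallyIntegrable_heaviside q).continuous_mul h₂)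

theorem hasDerivAt_mul_heaviside {f : ℝ → ℝ} (h : Differentiable ℝ f) {p x : ℝ} (hx : x ≠ p) :
    HasDerivAt (fun y => f y * heaviside (y - p)) (deriv f x * heaviside (x - p)) x := by
  refine ((h x).hasDerivAt.mul_const _).congr_of_eventuallyEq ?_
  have ht : Tendsto (fun y => y - p) (𝓝 x) (𝓝 (x - p)) := (continuous_sub_right p).tendsto x
  filter_upwards [ht.eventually (heaviside_eventuallyEq (sub_ne_zero.2 hx))] with y hy
  rw [hy]

theorem hasDerivAt_jumpFun {p q : ℝ} {f₀ f₁ f₂ : ℝ → ℝ} (h₀ : Differentiable ℝ f₀)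
    (h₁ : Differentiable ℝ f₁) (h₂ : Differentiable ℝ f₂) {x : ℝ} (hp : x ≠ p) (hq : x ≠ q) :
    HasDerivAt (jumpFun p q f₀ f₁ f₂) (jumpFun p q (deriv f₀) (deriv f₁) (deriv f₂) x) x :=
  ((h₀ x).hasDerivAt.add (hasDerivAt_mul_heaviside h₁ hp)).add (hasDerivAt_mul_heaviside h₂ hq)

/-- The fundamental theorem of calculus for the compactly supported `f g` on the half-line beyond
`p`; the end point produces the Dirac term. -/
theorem integral_mul_heaviside_mul_deriv {f g : ℝ → ℝ} (hf : ContDiff ℝ ∞ f)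
    {l₁ l₂ : ℝ} (hg : IsTest l₁ l₂ g) (p : ℝ) :
    ∫ x, f x * heaviside (x - p) * deriv g x
      = -(f p * g p) - ∫ x, deriv f x * heaviside (x - p) * g x := by
  have hf1 : Continuous (deriv f) := hf.continuous_deriv (by simp)
  have hfd : Differentiable ℝ f := hf.differentiable (by simp)
  have i1 : Integrable fun x => deriv f x * g x :=
    hg.integrable_mul (hf1.locallyIntegrable.locallyIntegrableOn _)
  have i2 : Integrable fun x => f x * deriv g x :=
    hg.deriv.integrable_mul (hf.continuous.locallyIntegrable.locallyIntegrableOn _)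
  have h := (hg.compact.mul_left (f := f)).integral_Ioi_deriv_eq
    ((hf.mul hg.smooth).of_le (by simp)) p
  have e : ∀ x, deriv (fun y => f y * g y) x = deriv f x * g x + f x * deriv g x := fun x =>
    deriv_fun_mul (hfd x) (hg.differentiable x)
  simp only [e] at h
  rw [integral_add i1.integrableOn i2.integrableOn] at h
  have e1 : ∀ x, f x * heaviside (x - p) * deriv g x = f x * deriv g x * heaviside (x - p) :=
    fun x => by ring
  have e2 : ∀ x, deriv f x * heaviside (x - p) * g x = deriv f x * g x * heaviside (x - p) :=
    fun x => by ring
  simp only [e1, e2, integral_mul_heaviside]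
  linarith

theorem integral_jumpFun_mul {p q : ℝ} {f₀ f₁ f₂ g : ℝ → ℝ} (h₀ : Continuous f₀)
    (h₁ : Continuous f₁) (h₂ : Continuous f₂) {l₁ l₂ : ℝ} (hg : IsTest l₁ l₂ g) :
    ∫ x, jumpFun p q f₀ f₁ f₂ x * g x = (∫ x, f₀ x * g x)
      + (∫ x, f₁ x * heaviside (x - p) * g x) + ∫ x, f₂ x * heaviside (x - q) * g x := by
  have i₀ := hg.integrable_mul (h₀.locallyIntegrable.locallyIntegrableOn _)
  have i₁ := hg.integrable_mul
    (((locallyIntegrable_heaviside p).continuous_mul h₁).locallyIntegrableOn _)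
  have i₂ := hg.integrable_mul
    (((locallyIntegrable_heaviside q).continuous_mul h₂).locallyIntegrableOn _)
  have i₀₁ : Integrable fun x => f₀ x * g x + f₁ x * heaviside (x - p) * g x := i₀.add i₁
  rw [← integral_add i₀ i₁, ← integral_add i₀₁ i₂]
  exact integral_congr_ae (ae_of_all _ fun x => by simp only [jumpFun]; ring)

theorem integral_jumpFun_mul_deriv {p q : ℝ} {f₀ f₁ f₂ g : ℝ → ℝ} (h₀ : ContDiff ℝ ∞ f₀)
    (h₁ : ContDiff ℝ ∞ f₁) (h₂ : ContDiff ℝ ∞ f₂) {l₁ l₂ : ℝ} (hg : IsTest l₁ l₂ g) :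
    ∫ x, jumpFun p q f₀ f₁ f₂ x * deriv g x
      = -(f₁ p * g p) - f₂ q * g q
        - ∫ x, jumpFun p q (deriv f₀) (deriv f₁) (deriv f₂) x * g x := by
  have c : ∀ {f : ℝ → ℝ}, ContDiff ℝ ∞ f → Continuous (deriv f) :=
    fun hf => hf.continuous_deriv (by simp)
  rw [integral_jumpFun_mul h₀.continuous h₁.continuous h₂.continuous hg.deriv,
    integral_jumpFun_mul (c h₀) (c h₁) (c h₂) hg, integral_mul_heaviside_mul_deriv h₁ hg,
    integral_mul_heaviside_mul_deriv h₂ hg]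
  have i1 := hg.deriv.integrable_mul (h₀.continuous.locallyIntegrable.locallyIntegrableOn _)
  have i2 := hg.integrable_mul ((c h₀).locallyIntegrable.locallyIntegrableOn _)
  have i3 := hg.integrable_mul (h₀.continuous.locallyIntegrable.locallyIntegrableOn _)
  have h := integral_mul_deriv_eq_deriv_mul_of_integrable (u := f₀) (v := g)
    (fun x _ => (h₀.differentiable (by simp) x).hasDerivAt)
    (fun x _ => (hg.differentiable x).hasDerivAt) i1 i2 i3
  rw [h]; ring

/-- The weak form of `∂_x² (e k) - 2 e' ∂_x k - e'' k = e ∂_x² k`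
for a continuous function `k` with kinks at `p` and `q`, where `e = 1`. -/
theorem integral_cutoff_jumpFun {p q : ℝ} {f₀ f₁ f₂ e ζ : ℝ → ℝ} (h₀ : ContDiff ℝ ∞ f₀)
    (h₁ : ContDiff ℝ ∞ f₁) (h₂ : ContDiff ℝ ∞ f₂) {l₁ l₂ : ℝ} (he : ContDiff ℝ ∞ e)
    (hζ : IsTest l₁ l₂ ζ) (hp : f₁ p = 0) (hq : f₂ q = 0) (ep : e p = 1) (eq : e q = 1) :
    (∫ x, (deriv e x * jumpFun p q f₀ f₁ f₂ x
        + e x * jumpFun p q (deriv f₀) (deriv f₁) (deriv f₂) x) * deriv ζ x)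
      + (∫ x, (2 * deriv e x * jumpFun p q (deriv f₀) (deriv f₁) (deriv f₂) x
        + iteratedDeriv 2 e x * jumpFun p q f₀ f₁ f₂ x) * ζ x)
    = -(deriv f₁ p * ζ p) - deriv f₂ q * ζ q
      - ∫ x, jumpFun p q (deriv (deriv f₀)) (deriv (deriv f₁)) (deriv (deriv f₂)) x
          * (e x * ζ x) := by
  have s : ∀ {f : ℝ → ℝ}, ContDiff ℝ ∞ f → ContDiff ℝ ∞ (deriv f) := fun hf =>
    (contDiff_infty_iff_deriv.1 hf).2
  have he' := s he
  have t1 := hζ.mul_left he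
  have t2 := hζ.mul_left he'
  set k := jumpFun p q f₀ f₁ f₂ with hk
  set k' := jumpFun p q (deriv f₀) (deriv f₁) (deriv f₂) with hk'
  have lk : LocallyIntegrable k :=
    locallyIntegrable_jumpFun h₀.continuous h₁.continuous h₂.continuous
  have lk' : LocallyIntegrable k' :=
    locallyIntegrable_jumpFun (s h₀).continuous (s h₁).continuous (s h₂).continuous
  have H1 := integral_jumpFun_mul_deriv (p := p) (q := q) (s h₀) (s h₁) (s h₂) t1
  have H2 := integral_jumpFun_mul_deriv (p := p) (q := q) h₀ h₁ h₂ t2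
  rw [← hk'] at H1
  rw [← hk, ← hk', hp, hq] at H2
  have d1 : ∀ x, deriv (fun x => e x * ζ x) x = deriv e x * ζ x + e x * deriv ζ x := fun x =>
    deriv_fun_mul (he.differentiable (by simp) x) (hζ.differentiable x)
  have d2 : ∀ x, deriv (fun x => deriv e x * ζ x) x
      = iteratedDeriv 2 e x * ζ x + deriv e x * deriv ζ x := fun x => by
    rw [deriv_fun_mul (he'.differentiable (by simp) x) (hζ.differentiable x),
      iteratedDeriv_succ, iteratedDeriv_one]
  have L1 : LocallyIntegrable fun x => deriv e x * k x + e x * k' x :=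
    (lk.continuous_mul he'.continuous).add (lk'.continuous_mul he.continuous)
  have L2 : LocallyIntegrable fun x => 2 * deriv e x * k' x + iteratedDeriv 2 e x * k x := by
    rw [iteratedDeriv_succ, iteratedDeriv_one]
    exact (lk'.continuous_mul (continuous_const.mul he'.continuous)).add
      (lk.continuous_mul (s he').continuous)
  have I1 := hζ.deriv.integrable_mul (L1.locallyIntegrableOn _)
  have I2 := hζ.integrable_mul (L2.locallyIntegrableOn _)
  have I3 := t1.deriv.integrable_mul (lk'.locallyIntegrableOn _)
  have I4 := t2.deriv.integrable_mul (lk.locallyIntegrableOn _)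
  have I5 := t2.integrable_mul (lk'.locallyIntegrableOn _)
  have I34 : Integrable fun x => k' x * deriv (fun x => e x * ζ x) x
      + k x * deriv (fun x => deriv e x * ζ x) x := I3.add I4
  -- The product rule moves the cut-off onto the test functions `e ζ` and `e' ζ`. Because `f₁ p = f₂
  -- q = 0`, integrating `k` by parts against `e' ζ` creates no point terms and cancels the last
  -- integral; the kinks appear only through `k'` against `e ζ`.
  have E : (∫ x, (deriv e x * k x + e x * k' x) * deriv ζ x)
      + (∫ x, (2 * deriv e x * k' x + iteratedDeriv 2 e x * k x) * ζ x)
      = (∫ x, k' x * deriv (fun x => e x * ζ x) x)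
        + (∫ x, k x * deriv (fun x => deriv e x * ζ x) x) + ∫ x, k' x * (deriv e x * ζ x) := by
    rw [← integral_add I1 I2, ← integral_add I3 I4, ← integral_add I34 I5]
    refine integral_congr_ae (ae_of_all _ fun x => ?_)
    simp only [d1, d2]; ring
  rw [E, H1, H2, ep, eq]
  ring


/-! ### Continuity of the temperature profile between the fronts. -/

theorem mul_heaviside_self (z : ℝ) : z * heaviside z = max z 0 := by
  rcases lt_or_ge z 0 with h | h
  · rw [heaviside_of_neg h, mul_zero, max_eq_right h.le]
  · rw [heaviside_of_nonneg h, mul_one, max_eq_left h]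

theorem mul_heaviside_neg (z : ℝ) : -z * heaviside (-z) = -z + z * heaviside z := by
  rw [mul_heaviside_self, mul_heaviside_self]
  rcases le_total z 0 with h | h
  · rw [max_eq_left (neg_nonneg.2 h), max_eq_right h, add_zero]
  · rw [max_eq_right (neg_nonpos.2 h), max_eq_left h, neg_add_cancel]

/-- The product of the parabola vanishing at `p` and `q` with the linear function equal to `a` at
`p` and to `b` at `q`, cut off outside the interval between `p` and `q`, in terms of the relative
position of `x` in this interval. -/
theorem linear_mul_parabola_cut (p q a b x : ℝ) :
    ((a + b) / 2 - (x - (p + q) / 2) * (a - b) / (q - p)) * ((p - x) * (x - q) / (q - p))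
        * (heaviside (x - p) - heaviside (x - q))
      = |q - p| * (max 0 (min 1 ((x - p) / (q - p))) * (1 - max 0 (min 1 ((x - p) / (q - p))))
        * (a * (1 - max 0 (min 1 ((x - p) / (q - p))))
          + b * max 0 (min 1 ((x - p) / (q - p))))) := by
  rcases lt_trichotomy p q with h | h | h
  · have h' : 0 < q - p := sub_pos.2 h
    have hne := h'.ne'
    rw [abs_of_pos h']
    rcases lt_or_ge x p with h1 | h1
    · have : (x - p) / (q - p) ≤ 0 := div_nonpos_of_nonpos_of_nonneg (by linarith) h'.le
      rw [heaviside_of_neg (by linarith), heaviside_of_neg (by linarith),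
        max_eq_left (min_le_of_right_le this)]
      ring
    · have h0 : 0 ≤ (x - p) / (q - p) := div_nonneg (by linarith) h'.le
      rcases lt_or_ge x q with h2 | h2
      · have : (x - p) / (q - p) ≤ 1 := (div_le_one h').2 (by linarith)
        rw [heaviside_of_nonneg (by linarith), heaviside_of_neg (by linarith), min_eq_right this,
          max_eq_right h0]
        field_simp
        ring
      · have : 1 ≤ (x - p) / (q - p) := (one_le_div h').2 (by linarith)
        rw [heaviside_of_nonneg (by linarith), heaviside_of_nonneg (by linarith),
          min_eq_left this, max_eq_right zero_le_one]
        ring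
  -- The Heaviside functions cancel on the left and `|q - p| = 0` on the right, whatever the
  -- quotient by zero is.
  · simp [h]
  · have h' : q - p < 0 := sub_neg.2 h
    have hne := h'.ne
    rw [abs_of_neg h']
    rcases lt_or_ge x q with h1 | h1
    · have : 1 ≤ (x - p) / (q - p) := (one_le_div_of_neg h').2 (by linarith)
      rw [heaviside_of_neg (by linarith), heaviside_of_neg (by linarith),
        min_eq_left this, max_eq_right zero_le_one]
      ring
    · have h0 : (x - p) / (q - p) ≤ 1 := (div_le_one_of_neg h').2 (by linarith)
      rcases lt_or_ge x p with h2 | h2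
      · have : 0 ≤ (x - p) / (q - p) := div_nonneg_of_nonpos (by linarith) h'.le
        rw [heaviside_of_neg (by linarith), heaviside_of_nonneg (by linarith), min_eq_right h0,
          max_eq_right this]
        field_simp
        ring
      · have : (x - p) / (q - p) ≤ 0 := div_nonpos_of_nonneg_of_nonpos (by linarith) h'.le
        rw [heaviside_of_nonneg (by linarith), heaviside_of_nonneg (by linarith),
          max_eq_left (min_le_of_right_le this)]
        ring

/-- Where `p ≠ q` the clamped relative position is continuous. Where `p = q` it need not be, but it
stays in `[0, 1]`, and the prefactor `|q - p|` drives the product to zero. -/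
theorem continuousOn_linear_mul_parabola_cut {X : Type*} [TopologicalSpace X] {S : Set X}
    {p q a b x : X → ℝ} (hp : ContinuousOn p S) (hq : ContinuousOn q S) (ha : ContinuousOn a S)
    (hb : ContinuousOn b S) (hx : ContinuousOn x S) :
    ContinuousOn (fun y => ((a y + b y) / 2 - (x y - (p y + q y) / 2) * (a y - b y) / (q y - p y))
      * ((p y - x y) * (x y - q y) / (q y - p y))
        * (heaviside (x y - p y) - heaviside (x y - q y))) S := by
  simp only [linear_mul_parabola_cut]
  intro y hy
  have hqp : ContinuousOn (fun y => q y - p y) S := hq.sub hp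
  by_cases h : q y - p y = 0
  · have hs : ∀ z, 0 ≤ max 0 (min 1 ((x z - p z) / (q z - p z))) ∧
        max 0 (min 1 ((x z - p z) / (q z - p z))) ≤ 1 := fun z =>
      ⟨le_max_left _ _, max_le zero_le_one (min_le_left _ _)⟩
    have hlim : Tendsto (fun z => |q z - p z| * (|a z| + |b z|)) (𝓝[S] y) (𝓝 0) := by
      have c : ContinuousOn (fun z => |q z - p z| * (|a z| + |b z|)) S :=
        hqp.abs.mul (ha.abs.add hb.abs)
      simpa [ContinuousWithinAt, h] using c y hy
    have : Tendsto (fun z => |q z - p z| * (max 0 (min 1 ((x z - p z) / (q z - p z)))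
        * (1 - max 0 (min 1 ((x z - p z) / (q z - p z))))
        * (a z * (1 - max 0 (min 1 ((x z - p z) / (q z - p z))))
          + b z * max 0 (min 1 ((x z - p z) / (q z - p z)))))) (𝓝[S] y) (𝓝 0) := by
      refine squeeze_zero_norm (fun z => ?_) hlim
      obtain ⟨h0, h1⟩ := hs z
      set s := max 0 (min 1 ((x z - p z) / (q z - p z)))
      rw [Real.norm_eq_abs, abs_mul, abs_abs]
      refine mul_le_mul_of_nonneg_left ?_ (abs_nonneg _)
      rw [abs_mul, abs_of_nonneg (mul_nonneg h0 (by linarith))]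
      have h2 : |a z * (1 - s) + b z * s| ≤ |a z| + |b z| := by
        refine (abs_add_le _ _).trans ?_
        rw [abs_mul, abs_mul, abs_of_nonneg h0, abs_of_nonneg (by linarith : 0 ≤ 1 - s)]
        exact add_le_add (mul_le_of_le_one_right (abs_nonneg _) (by linarith))
          (mul_le_of_le_one_right (abs_nonneg _) h1)
      refine (mul_le_of_le_one_left (abs_nonneg _) ?_).trans h2
      nlinarith
    rw [ContinuousWithinAt, h, abs_zero, zero_mul]
    exact this
  · have hs : ContinuousWithinAt (fun z => max 0 (min 1 ((x z - p z) / (q z - p z)))) S y := by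
      have h1 := ((hx.sub hp) y hy).div (hqp y hy) h
      have h2 : ContinuousWithinAt (fun z => min 1 ((x z - p z) / (q z - p z))) S y :=
        Filter.Tendsto.min tendsto_const_nhds h1
      exact Filter.Tendsto.max tendsto_const_nhds h2
    exact (hqp y hy).abs.mul ((hs.mul (continuousWithinAt_const.sub hs)).mul
      (((ha y hy).mul (continuousWithinAt_const.sub hs)).add ((hb y hy).mul hs)))

/-! ### Kinks of `K` at the fronts. -/

namespace Ansatz

variable {A : Ansatz} {ε t : ℝ}

variable (A) in
/-- The smooth function which is added to `K` between the fronts. -/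
noncomputable def Q (ε x t : ℝ) : ℝ :=
  A.B (A.τ ε t) * (A.γMinus ε x t * A.P ε x t)
    - (1 - A.B (A.τ ε t)) * (A.γHat ε x t * A.P ε x t)

/-- Using only the steps `H(x - φ_i)` puts `K` into the form `jumpFun`, where each step coefficient
vanishes at its own front: `K` has kinks but no jumps. -/
theorem K_eq_sum (ε x t : ℝ) : A.K ε x t = A.γm 0 t * (A.φ 0 ε t - x)
    + (A.γm 0 t * (x - A.φ 0 ε t) + A.Q ε x t) * heaviside (x - A.φ 0 ε t)
    + (A.γp 1 t * (x - A.φ 1 ε t) - A.Q ε x t) * heaviside (x - A.φ 1 ε t) := by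
  have h := mul_heaviside_neg (x - A.φ 0 ε t)
  rw [neg_sub] at h
  simp only [K, Q, D]
  linear_combination A.γm 0 t * h

theorem K_eq_jumpFun (ε t : ℝ) : (fun x => A.K ε x t) = jumpFun (A.φ 0 ε t) (A.φ 1 ε t)
    (fun x => A.γm 0 t * (A.φ 0 ε t - x)) (fun x => A.γm 0 t * (x - A.φ 0 ε t) + A.Q ε x t)
    (fun x => A.γp 1 t * (x - A.φ 1 ε t) - A.Q ε x t) :=
  funext fun x => K_eq_sum ε x t

theorem contDiff_γMinus_mul_P (ε t : ℝ) :
    ContDiff ℝ ∞ fun x => A.γMinus ε x t * A.P ε x t := by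
  unfold γMinus P; fun_prop

theorem contDiff_γHat_mul_P (ε t : ℝ) :
    ContDiff ℝ ∞ fun x => A.γHat ε x t * A.P ε x t := by
  unfold γHat P; fun_prop

theorem contDiff_Q (ε t : ℝ) : ContDiff ℝ ∞ fun x => A.Q ε x t :=
  (contDiff_const.mul (contDiff_γMinus_mul_P ε t)).sub
    (contDiff_const.mul (contDiff_γHat_mul_P ε t))

theorem Q_φ (i : Fin 2) (ε t : ℝ) : A.Q ε (A.φ i ε t) t = 0 := by
  fin_cases i <;> simp [Q, P]

/-- Division by zero gives `P = 0`, so the same decomposition of `K` remains valid at the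
confluence. -/
theorem Q_eq_zero (h : A.ψ ε t = 0) (x : ℝ) : A.Q ε x t = 0 := by
  simp [Q, P, h]

/-- `P` vanishes at both fronts with slopes `1` and `-1`, so only the value of `f` there survives in
the product rule. -/
theorem deriv_mul_P {f : ℝ → ℝ} (hf : Differentiable ℝ f) (i : Fin 2) (h : A.ψ ε t ≠ 0) :
    deriv (fun x => f x * A.P ε x t) (A.φ i ε t) = (-1) ^ (i : ℕ) * f (A.φ i ε t) := by
  have hP : HasDerivAt (fun x => A.P ε x t) ((-1) ^ (i : ℕ)) (A.φ i ε t) := by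
    have := (((hasDerivAt_id (A.φ i ε t)).const_sub (A.φ 0 ε t)).mul
      ((hasDerivAt_id (A.φ i ε t)).sub_const (A.φ 1 ε t))).div_const (A.ψ ε t)
    refine this.congr_deriv ?_
    rw [div_eq_iff h]
    fin_cases i <;> simp [ψ]
  rw [((hf _).hasDerivAt.fun_mul hP).deriv]
  have : A.P ε (A.φ i ε t) t = 0 := by fin_cases i <;> simp [P]
  rw [this]; ring

theorem γMinus_φ_zero (h : A.ψ ε t ≠ 0) : A.γMinus ε (A.φ 0 ε t) t = A.γp 0 t := by
  have : A.φ 0 ε t - A.xs ε t = -A.ψ ε t / 2 := by simp only [xs, ψ]; ring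
  rw [γMinus, this]; field_simp; ring

theorem γMinus_φ_one (h : A.ψ ε t ≠ 0) : A.γMinus ε (A.φ 1 ε t) t = A.γm 1 t := by
  have : A.φ 1 ε t - A.xs ε t = A.ψ ε t / 2 := by simp only [xs, ψ]; ring
  rw [γMinus, this]; field_simp; ring

theorem γHat_φ_zero (h : A.ψ ε t ≠ 0) : A.γHat ε (A.φ 0 ε t) t = A.γm 0 t := by
  have : A.φ 0 ε t - A.xs ε t = -A.ψ ε t / 2 := by simp only [xs, ψ]; ring
  rw [γHat, this]; field_simp; ring

theorem γHat_φ_one (h : A.ψ ε t ≠ 0) : A.γHat ε (A.φ 1 ε t) t = A.γp 1 t := by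
  have : A.φ 1 ε t - A.xs ε t = A.ψ ε t / 2 := by simp only [xs, ψ]; ring
  rw [γHat, this]; field_simp; ring

theorem deriv_Q_eq (ε t : ℝ) : deriv (fun x => A.Q ε x t) = fun x =>
    A.B (A.τ ε t) * deriv (fun x => A.γMinus ε x t * A.P ε x t) x
      - (1 - A.B (A.τ ε t)) * deriv (fun x => A.γHat ε x t * A.P ε x t) x := by
  funext x
  have h1 := ((contDiff_γMinus_mul_P (A := A) ε t).differentiable (by simp) x).hasDerivAt
  have h2 := ((contDiff_γHat_mul_P (A := A) ε t).differentiable (by simp) x).hasDerivAt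
  exact ((h1.const_mul _).sub (h2.const_mul _)).deriv

theorem deriv_deriv_Q (ε x t : ℝ) : deriv (deriv fun x => A.Q ε x t) x =
    iteratedDeriv 2 (fun x => A.γMinus ε x t * A.P ε x t) x * A.B (A.τ ε t)
      - iteratedDeriv 2 (fun x => A.γHat ε x t * A.P ε x t) x * (1 - A.B (A.τ ε t)) := by
  have s : ∀ {f : ℝ → ℝ}, ContDiff ℝ ∞ f → DifferentiableAt ℝ (deriv f) x := fun hf =>
    (contDiff_infty_iff_deriv.1 hf).2.differentiable (by simp) x
  have h1 := (s (contDiff_γMinus_mul_P (A := A) ε t)).hasDerivAt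
  have h2 := (s (contDiff_γHat_mul_P (A := A) ε t)).hasDerivAt
  rw [deriv_Q_eq, ((h1.const_mul _).fun_sub (h2.const_mul _)).deriv]
  simp only [iteratedDeriv_succ, iteratedDeriv_zero]
  ring

theorem differentiable_γMinus (ε t : ℝ) : Differentiable ℝ fun x => A.γMinus ε x t := by
  unfold γMinus; fun_prop

theorem differentiable_γHat (ε t : ℝ) : Differentiable ℝ fun x => A.γHat ε x t := by
  unfold γHat; fun_prop

/-- Added to the slope `γ_1^-` of the linear part of the step coefficient, this gives the jump `B
(γ_1^+ + γ_1^-)`: the terms without `B` cancel. -/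
theorem deriv_Q_φ_zero (h : A.ψ ε t ≠ 0) : deriv (fun x => A.Q ε x t) (A.φ 0 ε t)
    = A.B (A.τ ε t) * A.γp 0 t - (1 - A.B (A.τ ε t)) * A.γm 0 t := by
  rw [deriv_Q_eq]
  simp only [deriv_mul_P (differentiable_γMinus ε t) 0 h, deriv_mul_P (differentiable_γHat ε t) 0 h,
    γMinus_φ_zero h, γHat_φ_zero h, Fin.val_zero, pow_zero, one_mul]

theorem deriv_Q_φ_one (h : A.ψ ε t ≠ 0) : deriv (fun x => A.Q ε x t) (A.φ 1 ε t)
    = -(A.B (A.τ ε t) * A.γm 1 t) + (1 - A.B (A.τ ε t)) * A.γp 1 t := by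
  rw [deriv_Q_eq]
  simp only [deriv_mul_P (differentiable_γMinus ε t) 1 h, deriv_mul_P (differentiable_γHat ε t) 1 h,
    γMinus_φ_one h, γHat_φ_one h, Fin.val_one, pow_one]
  ring

theorem e_φ (i : Fin 2) (hε : ε ∈ Ioo 0 A.ε₀) (ht : t ∈ Icc 0 A.t₁) : A.e (A.φ i ε t) = 1 := by
  refine A.e_one ε hε t ht _ ?_
  fin_cases i
  · exact left_mem_uIcc
  · exact right_mem_uIcc

/-- `D` is supported between the fronts, where the cut-off equals one; this removes `e` from the
regular part of `e ∂_x² K`. -/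
theorem D_mul_e (hε : ε ∈ Ioo 0 A.ε₀) (ht : t ∈ Icc 0 A.t₁) (x : ℝ) :
    A.D ε x t * A.e x = A.D ε x t := by
  by_cases hx : x ∈ uIcc (A.φ 0 ε t) (A.φ 1 ε t)
  · rw [A.e_one ε hε t ht x hx, mul_one]
  · have : A.D ε x t = 0 := by
      rw [mem_uIcc, not_or, not_and_or, not_and_or] at hx
      simp only [not_le] at hx
      unfold D
      rcases lt_or_ge x (A.φ 0 ε t) with h0 | h0 <;> rcases lt_or_ge x (A.φ 1 ε t) with h1 | h1
      · rw [heaviside_of_neg (by linarith), heaviside_of_neg (by linarith), sub_zero]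
      · rcases hx.2 with h | h <;> linarith
      · rcases hx.1 with h | h <;> linarith
      · rw [heaviside_of_nonneg (by linarith), heaviside_of_nonneg (by linarith), sub_self]
    rw [this, zero_mul]

variable (A) in
/-- The derivative of `K` in `x` off the fronts. -/
noncomputable def Kx (ε t : ℝ) : ℝ → ℝ := jumpFun (A.φ 0 ε t) (A.φ 1 ε t)
    (deriv fun x => A.γm 0 t * (A.φ 0 ε t - x))
    (deriv fun x => A.γm 0 t * (x - A.φ 0 ε t) + A.Q ε x t)
    (deriv fun x => A.γp 1 t * (x - A.φ 1 ε t) - A.Q ε x t)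

section Jumps

variable (A ε t)

theorem contDiff_left : ContDiff ℝ ∞ fun x => A.γm 0 t * (A.φ 0 ε t - x) := by fun_prop

theorem contDiff_jump_zero :
    ContDiff ℝ ∞ fun x => A.γm 0 t * (x - A.φ 0 ε t) + A.Q ε x t :=
  ContDiff.add (by fun_prop) (contDiff_Q ε t)

theorem contDiff_jump_one :
    ContDiff ℝ ∞ fun x => A.γp 1 t * (x - A.φ 1 ε t) - A.Q ε x t :=
  ContDiff.sub (by fun_prop) (contDiff_Q ε t)

theorem deriv_left : (deriv fun x => A.γm 0 t * (A.φ 0 ε t - x)) = fun _ => -A.γm 0 t := by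
  funext x
  rw [(((hasDerivAt_id' x).const_sub (A.φ 0 ε t)).const_mul (A.γm 0 t)).deriv]; ring

theorem deriv_jump_zero : (deriv fun x => A.γm 0 t * (x - A.φ 0 ε t) + A.Q ε x t)
    = fun x => A.γm 0 t + deriv (fun x => A.Q ε x t) x := by
  funext x
  rw [((((hasDerivAt_id' x).sub_const (A.φ 0 ε t)).const_mul (A.γm 0 t)).fun_add
    ((contDiff_Q (A := A) ε t).differentiable (by simp) x).hasDerivAt).deriv, mul_one]

theorem deriv_jump_one : (deriv fun x => A.γp 1 t * (x - A.φ 1 ε t) - A.Q ε x t)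
    = fun x => A.γp 1 t - deriv (fun x => A.Q ε x t) x := by
  funext x
  rw [((((hasDerivAt_id' x).sub_const (A.φ 1 ε t)).const_mul (A.γp 1 t)).fun_sub
    ((contDiff_Q (A := A) ε t).differentiable (by simp) x).hasDerivAt).deriv, mul_one]

theorem K_locallyIntegrable : LocallyIntegrable fun x => A.K ε x t := by
  rw [K_eq_jumpFun]
  exact locallyIntegrable_jumpFun (A.contDiff_left ε t).continuous
    (A.contDiff_jump_zero ε t).continuous (A.contDiff_jump_one ε t).continuous

theorem Kx_locallyIntegrable : LocallyIntegrable (A.Kx ε t) :=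
  locallyIntegrable_jumpFun ((A.contDiff_left ε t).continuous_deriv (by simp))
    ((A.contDiff_jump_zero ε t).continuous_deriv (by simp))
    ((A.contDiff_jump_one ε t).continuous_deriv (by simp))

variable {A ε t}

theorem K_hasDerivAt {x : ℝ} (h0 : x ≠ A.φ 0 ε t) (h1 : x ≠ A.φ 1 ε t) :
    HasDerivAt (fun y => A.K ε y t) (A.Kx ε t x) x := by
  rw [K_eq_jumpFun]
  exact hasDerivAt_jumpFun ((A.contDiff_left ε t).differentiable (by simp))
    ((A.contDiff_jump_zero ε t).differentiable (by simp))
    ((A.contDiff_jump_one ε t).differentiable (by simp)) h0 h1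

/-- The jumps of `∂_x K` at the fronts, as seen by the heat equation with the cut-off `e`. -/
theorem integral_cutoff_K (hε : ε ∈ Ioo 0 A.ε₀) (ht : t ∈ Icc 0 A.t₁) {ζ : ℝ → ℝ}
    (hζ : IsTest A.l₁ A.l₂ ζ) :
    (∫ x, (deriv A.e x * A.K ε x t + A.e x * A.Kx ε t x) * deriv ζ x)
      + (∫ x, (2 * deriv A.e x * A.Kx ε t x + iteratedDeriv 2 A.e x * A.K ε x t) * ζ x)
      + A.singular ε t ζ
    = -∑ i : Fin 2, A.B (A.τ ε t) * (A.γp i t + A.γm i t) * ζ (A.φ i ε t) := by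
  have H := integral_cutoff_jumpFun (A.contDiff_left ε t) (A.contDiff_jump_zero ε t)
    (A.contDiff_jump_one ε t) A.e_test.smooth hζ (p := A.φ 0 ε t) (q := A.φ 1 ε t)
    (by simp [Q_φ]) (by simp [Q_φ]) (e_φ 0 hε ht) (e_φ 1 hε ht)
  rw [← K_eq_jumpFun] at H
  change (∫ x, (deriv A.e x * A.K ε x t + A.e x * A.Kx ε t x) * deriv ζ x)
    + (∫ x, (2 * deriv A.e x * A.Kx ε t x + iteratedDeriv 2 A.e x * A.K ε x t) * ζ x) = _ at H
  rw [H, Fin.sum_univ_two]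
  simp only [deriv_left, deriv_jump_zero, deriv_jump_one]
  -- Second derivatives kill the affine parts, and `Q` enters the two steps with opposite signs,
  -- which assembles `D`.
  have hD : ∀ x, jumpFun (A.φ 0 ε t) (A.φ 1 ε t) (deriv fun _ => -A.γm 0 t)
      (deriv fun x => A.γm 0 t + deriv (fun x => A.Q ε x t) x)
      (deriv fun x => A.γp 1 t - deriv (fun x => A.Q ε x t) x) x * (A.e x * ζ x)
      = deriv (deriv fun x => A.Q ε x t) x * A.D ε x t * ζ x := fun x => by
    rw [mul_assoc _ (A.D ε x t), ← D_mul_e hε ht x]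
    simp only [jumpFun, deriv_const', deriv_const_add, deriv_const_sub, D]
    ring
  simp only [hD]
  -- At the confluence both kinks sit at one point and have total slope jump `γ_1^- + γ_2^+`; the
  -- Dirac mass in `singular` corrects this to `B` times the sum of all four coefficients.
  by_cases h : A.ψ ε t = 0
  · have h01 : A.φ 1 ε t = A.φ 0 ε t := sub_eq_zero.1 h
    have hQ : (fun x => A.Q ε x t) = fun _ => 0 := funext (Q_eq_zero h)
    rw [singular, if_pos h, hQ, h01]
    simp
    ring
  · rw [singular, if_neg h, hζ.setIntegral_eq, deriv_Q_φ_zero h, deriv_Q_φ_one h]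
    have : ∀ x, (iteratedDeriv 2 (fun y => A.γMinus ε y t * A.P ε y t) x * A.B (A.τ ε t)
          * A.D ε x t
        + iteratedDeriv 2 (fun y => A.γHat ε y t * A.P ε y t) x * (1 - A.B (A.τ ε t))
          * -A.D ε x t) = deriv (deriv fun x => A.Q ε x t) x * A.D ε x t := fun x => by
      rw [deriv_deriv_Q]; ring
    simp only [this]
    ring

end Jumps


/-! ### Time derivative of `K` off the fronts. -/

variable (A) in
/-- `f x s` is differentiable in `s` at `t`, and its value and derivative at `t` are continuous
in `x`. -/
def HasContDerivAt (t : ℝ) (f : ℝ → ℝ → ℝ) : Prop :=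
  (Continuous fun x => f x t) ∧
    ∃ g, Continuous g ∧ ∀ x, HasDerivWithinAt (fun s => f x s) (g x) (Icc 0 A.t₁) t

namespace HasContDerivAt

variable {f g : ℝ → ℝ → ℝ}

theorem of_time {c : ℝ → ℝ} {c' : ℝ} (h : HasDerivWithinAt c c' (Icc 0 A.t₁) t) :
    A.HasContDerivAt t fun _ s => c s :=
  ⟨continuous_const, fun _ => c', continuous_const, fun _ => h⟩

theorem of_space {c : ℝ → ℝ} (h : Continuous c) : A.HasContDerivAt t fun x _ => c x :=
  ⟨h, fun _ => 0, continuous_const, fun _ => hasDerivWithinAt_const _ _ _⟩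

theorem add (hf : A.HasContDerivAt t f) (hg : A.HasContDerivAt t g) :
    A.HasContDerivAt t fun x s => f x s + g x s := by
  obtain ⟨cf, f', cf', hf⟩ := hf
  obtain ⟨cg, g', cg', hg⟩ := hg
  exact ⟨cf.add cg, fun x => f' x + g' x, cf'.add cg', fun x => (hf x).add (hg x)⟩

theorem sub (hf : A.HasContDerivAt t f) (hg : A.HasContDerivAt t g) :
    A.HasContDerivAt t fun x s => f x s - g x s := by
  obtain ⟨cf, f', cf', hf⟩ := hf
  obtain ⟨cg, g', cg', hg⟩ := hg
  exact ⟨cf.sub cg, fun x => f' x - g' x, cf'.sub cg', fun x => (hf x).sub (hg x)⟩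

theorem mul (hf : A.HasContDerivAt t f) (hg : A.HasContDerivAt t g) :
    A.HasContDerivAt t fun x s => f x s * g x s := by
  obtain ⟨cf, f', cf', hf⟩ := hf
  obtain ⟨cg, g', cg', hg⟩ := hg
  exact ⟨cf.mul cg, fun x => f' x * g x t + f x t * g' x, (cf'.mul cg).add (cf.mul cg'),
    fun x => (hf x).mul (hg x)⟩

theorem div_time (hf : A.HasContDerivAt t f) {c : ℝ → ℝ} {c' : ℝ}
    (h : HasDerivWithinAt c c' (Icc 0 A.t₁) t) (h0 : c t ≠ 0) :
    A.HasContDerivAt t fun x s => f x s / c s := by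
  simp only [div_eq_mul_inv]
  exact hf.mul (of_time (h.inv h0))

end HasContDerivAt

open HasContDerivAt

theorem φ_hasContDerivAt (hε : ε ∈ Ioo 0 A.ε₀) (ht : t ∈ Icc 0 A.t₁)
    (i : Fin 2) : A.HasContDerivAt t fun _ s => A.φ i ε s :=
  of_time (φ_hasDeriv i hε ht)

theorem hasContDerivAt_linear (hε : ε ∈ Ioo 0 A.ε₀) (ht : t ∈ Icc 0 A.t₁)
    {a b : ℝ → ℝ} (ha : ContDiffOn ℝ 1 a (Icc 0 A.t₁))
    (hb : ContDiffOn ℝ 1 b (Icc 0 A.t₁)) (hψ : A.ψ ε t ≠ 0) :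
    A.HasContDerivAt t fun x s =>
      (a s + b s) / 2 - (x - A.xs ε s) * (a s - b s) / A.ψ ε s := by
  have ha' := of_time (hasDerivWithinAt_dt ha ht)
  have hb' := of_time (hasDerivWithinAt_dt hb ht)
  have h0 := φ_hasContDerivAt hε ht 0
  have h1 := φ_hasContDerivAt hε ht 1
  have h2 : HasDerivWithinAt (fun _ : ℝ => (2 : ℝ)) 0 (Icc 0 A.t₁) t := hasDerivWithinAt_const _ _ _
  have hxs : A.HasContDerivAt t fun _ s => A.xs ε s := (h0.add h1).div_time h2 two_ne_zero
  exact ((ha'.add hb').div_time h2 two_ne_zero).sub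
    ((((of_space continuous_id).sub hxs).mul (ha'.sub hb')).div_time
      ((φ_hasDeriv 1 hε ht).sub (φ_hasDeriv 0 hε ht)) hψ)

theorem Q_hasContDerivAt (hε : ε ∈ Ioo 0 A.ε₀) (ht : t ∈ Icc 0 A.t₁)
    (hψ : A.ψ ε t ≠ 0) : A.HasContDerivAt t fun x s => A.Q ε x s := by
  have hP : A.HasContDerivAt t fun x s => A.P ε x s :=
    (((φ_hasContDerivAt hε ht 0).sub (of_space continuous_id)).mul
      ((of_space continuous_id).sub (φ_hasContDerivAt hε ht 1))).div_time
      ((φ_hasDeriv 1 hε ht).sub (φ_hasDeriv 0 hε ht)) hψ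
  have hB : A.HasContDerivAt t fun _ s => A.B (A.τ ε s) := of_time
    (((A.B_smooth.differentiable (by simp)) _).hasDerivAt.comp_hasDerivWithinAt t (τ_hasDeriv ht))
  exact (hB.mul ((hasContDerivAt_linear hε ht (A.γp_smooth 0) (A.γm_smooth 1) hψ).mul hP)).sub
    (((of_space continuous_const).sub hB).mul
      ((hasContDerivAt_linear hε ht (A.γm_smooth 0) (A.γp_smooth 1) hψ).mul hP))

theorem heaviside_sub_φ_eventuallyEq (hε : ε ∈ Ioo 0 A.ε₀) (ht : t ∈ Icc 0 A.t₁)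
    (i : Fin 2) {x : ℝ} (hx : x ≠ A.φ i ε t) :
    ∀ᶠ s in 𝓝[Icc 0 A.t₁] t, heaviside (x - A.φ i ε s) = heaviside (x - A.φ i ε t) :=
  ((φ_hasDeriv i hε ht).continuousWithinAt.const_sub x).eventually
    (heaviside_eventuallyEq (sub_ne_zero.2 hx))

/-- The derivative of `K` in `t` off the fronts. -/
theorem exists_K_hasDerivWithinAt (hε : ε ∈ Ioo 0 A.ε₀) (ht : t ∈ Icc 0 A.t₁) : ∃ g₀ g₁ g₂ : ℝ → ℝ, Continuous g₀ ∧ Continuous g₁ ∧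
    Continuous g₂ ∧ ∀ x, x ≠ A.φ 0 ε t → x ≠ A.φ 1 ε t →
      HasDerivWithinAt (fun s => A.K ε x s)
        (jumpFun (A.φ 0 ε t) (A.φ 1 ε t) g₀ g₁ g₂ x) (Icc 0 A.t₁) t := by
  have h0 := φ_hasContDerivAt hε ht 0
  have h1 := φ_hasContDerivAt hε ht 1
  have hx : A.HasContDerivAt t fun x _ => x := of_space continuous_id
  have c0 := of_time (hasDerivWithinAt_dt (A.γm_smooth 0) ht)
  have c1 := of_time (hasDerivWithinAt_dt (A.γp_smooth 1) ht)
  -- With a zero of `ψ` at `t`, the denominators in `Q` obstruct differentiating it in time. There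
  -- `Q` may be replaced by `0`, because the Heaviside functions frozen at time `t` coincide and `Q`
  -- enters `K` only through their difference.
  obtain ⟨R, hR, hRQ⟩ : ∃ R : ℝ → ℝ → ℝ, A.HasContDerivAt t R ∧
      ∀ x, x ≠ A.φ 0 ε t → x ≠ A.φ 1 ε t → ∀ s,
        A.Q ε x s * (heaviside (x - A.φ 0 ε t) - heaviside (x - A.φ 1 ε t))
          = R x s * (heaviside (x - A.φ 0 ε t) - heaviside (x - A.φ 1 ε t)) := by
    by_cases hψ : A.ψ ε t = 0
    · refine ⟨fun _ _ => 0, of_space continuous_const, fun x _ _ s => ?_⟩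
      rw [sub_eq_zero.1 hψ]; simp
    · exact ⟨_, Q_hasContDerivAt hε ht hψ, fun _ _ _ _ => rfl⟩
  obtain ⟨-, g₀, hg₀, d₀⟩ := c0.mul (h0.sub hx)
  obtain ⟨-, g₁, hg₁, d₁⟩ := (c0.mul (hx.sub h0)).add hR
  obtain ⟨-, g₂, hg₂, d₂⟩ := (c1.mul (hx.sub h1)).sub hR
  refine ⟨g₀, g₁, g₂, hg₀, hg₁, hg₂, fun x hx0 hx1 => ?_⟩
  have d := ((d₀ x).add ((d₁ x).mul_const (heaviside (x - A.φ 0 ε t)))).add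
    ((d₂ x).mul_const (heaviside (x - A.φ 1 ε t)))
  -- Off the fronts the Heaviside factors are locally constant in time, so they can be frozen at
  -- `t`.
  have hev : (fun s => A.K ε x s) =ᶠ[𝓝[Icc 0 A.t₁] t] fun s =>
      A.γm 0 s * (A.φ 0 ε s - x)
        + (A.γm 0 s * (x - A.φ 0 ε s) + R x s) * heaviside (x - A.φ 0 ε t)
        + (A.γp 1 s * (x - A.φ 1 ε s) - R x s) * heaviside (x - A.φ 1 ε t) := by
    filter_upwards [heaviside_sub_φ_eventuallyEq hε ht 0 hx0,
      heaviside_sub_φ_eventuallyEq hε ht 1 hx1] with s e0 e1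
    rw [K_eq_sum, e0, e1]
    linear_combination hRQ x hx0 hx1 s
  exact d.congr_of_eventuallyEq hev (hev.self_of_nhdsWithin ht)

/-! ### Joint continuity in space and time. -/

theorem continuousOn_comp_snd {f : ℝ → ℝ} (hf : ContinuousOn f (Icc 0 A.t₁)) (S : Set ℝ) :
    ContinuousOn (fun p : ℝ × ℝ => f p.2) (S ×ˢ Icc 0 A.t₁) :=
  hf.comp continuousOn_snd fun _ hp => hp.2

theorem τ_continuousOn : ContinuousOn (A.τ ε) (Icc 0 A.t₁) :=
  A.ψ0_smooth.continuousOn.div_const ε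

theorem K_continuousOn (hε : ε ∈ Ioo 0 A.ε₀) (S : Set ℝ) :
    ContinuousOn (fun p : ℝ × ℝ => A.K ε p.1 p.2) (S ×ˢ Icc 0 A.t₁) := by
  have hφ := fun i => continuousOn_comp_snd (A.φ_smooth i ε hε).continuousOn S
  have hp := fun i => continuousOn_comp_snd (A.γp_smooth i).continuousOn S
  have hm := fun i => continuousOn_comp_snd (A.γm_smooth i).continuousOn S
  have hx : ContinuousOn (fun p : ℝ × ℝ => p.1) (S ×ˢ Icc 0 A.t₁) := continuousOn_fst
  have hB := continuousOn_comp_snd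
    (A.B_smooth.continuous.comp_continuousOn (τ_continuousOn (A := A) (ε := ε))) S
  have pos : ∀ {f : ℝ × ℝ → ℝ}, ContinuousOn f (S ×ˢ Icc 0 A.t₁) →
      ContinuousOn (fun p => f p * heaviside (f p)) (S ×ˢ Icc 0 A.t₁) := fun hf => by
    simp only [mul_heaviside_self]
    exact fun p hp => Filter.Tendsto.max (hf p hp) tendsto_const_nhds
  have h1 := continuousOn_linear_mul_parabola_cut (hφ 0) (hφ 1) (hp 0) (hm 1) hx
  have h2 := continuousOn_linear_mul_parabola_cut (hφ 0) (hφ 1) (hm 0) (hp 1) hx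
  refine ((((hm 0).mul (pos ((hφ 0).sub hx))).add ((hp 1).mul (pos (hx.sub (hφ 1))))).add
    ((hB.mul h1).sub (((continuousOn_const (c := (1 : ℝ))).sub hB).mul h2))).congr fun p _ => ?_
  simp only [K, γMinus, γHat, P, D, xs, ψ, Pi.add_apply, Pi.mul_apply, Pi.sub_apply,
    Function.comp_apply]
  ring

theorem u_continuousOn (hε : ε ∈ Ioo 0 A.ε₀) (S : Set ℝ) :
    ContinuousOn (fun p : ℝ × ℝ => A.u ε p.1 p.2) (S ×ˢ Icc 0 A.t₁) := by
  have hφ := fun i => continuousOn_comp_snd (A.φ_smooth i ε hε).continuousOn S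
  have hx : ContinuousOn (fun p : ℝ × ℝ => p.1) (S ×ˢ Icc 0 A.t₁) := continuousOn_fst
  have hβ := continuousOn_comp_snd
    (A.β_smooth.continuous.comp_continuousOn (τ_continuousOn (A := A) (ε := ε))) S
  have ha := continuous_tanh.comp_continuousOn (hβ.mul (((hφ 0).sub hx).div_const ε))
  have hb := continuous_tanh.comp_continuousOn (hβ.mul ((hx.sub (hφ 1)).div_const ε))
  exact continuousOn_const.mul (((continuousOn_const.add ha).add hb).sub (ha.mul hb))

/-! ### Reduction of the weak form to the fronts, and conclusion. -/

/-- Absorbing `e I` into `w` avoids differentiating `I`, which has `ψ` in its denominator;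
regularity of `w` is assumed directly. -/
theorem θ_eq (qc qh : ℝ → ℝ → ℝ → ℝ) (ε x t : ℝ) :
    A.θ qc qh ε x t = A.e x * A.K ε x t + A.w qc qh ε x t := by
  simp only [θ, T, w]; ring

theorem ae_off_fronts {p : ℝ → Prop} (ε t : ℝ)
    (h : ∀ x ∈ Ioo A.l₁ A.l₂, x ≠ A.φ 0 ε t → x ≠ A.φ 1 ε t → p x) :
    ∀ᵐ x ∂volume.restrict (Ioo A.l₁ A.l₂), p x := by
  rw [ae_restrict_iff' measurableSet_Ioo]
  filter_upwards [Measure.ae_ne volume (A.φ 0 ε t), Measure.ae_ne volume (A.φ 1 ε t)]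
    with x h0 h1 hx using h x hx h0 h1

theorem θ_hasDerivAt {J : Set ℝ} {qc qh : ℝ → ℝ → ℝ → ℝ} (hq : A.SolvesHeat J qc qh)
    (hε : ε ∈ Ioo 0 A.ε₀) (ht : t ∈ J) {x : ℝ} (hx : x ∈ Ioo A.l₁ A.l₂) (h0 : x ≠ A.φ 0 ε t)
    (h1 : x ≠ A.φ 1 ε t) :
    HasDerivAt (fun y => A.θ qc qh ε y t) (deriv A.e x * A.K ε x t + A.e x * A.Kx ε t x
      + deriv (fun y => A.w qc qh ε y t) x) x := by
  simp only [θ_eq]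
  exact ((A.e_test.differentiable x).hasDerivAt.mul (K_hasDerivAt h0 h1)).add
    (hq.diff ε hε t ht x hx h0 h1).1.hasDerivAt

theorem θ_hasDerivWithinAt {J : Set ℝ} {qc qh : ℝ → ℝ → ℝ → ℝ} (hq : A.SolvesHeat J qc qh)
    (hε : ε ∈ Ioo 0 A.ε₀) (ht : t ∈ J) {x k : ℝ} (hx : x ∈ Ioo A.l₁ A.l₂) (h0 : x ≠ A.φ 0 ε t)
    (h1 : x ≠ A.φ 1 ε t) (hk : HasDerivWithinAt (fun s => A.K ε x s) k (Icc 0 A.t₁) t) :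
    HasDerivWithinAt (fun s => A.θ qc qh ε x s)
      (A.e x * k + A.dt (fun s => A.w qc qh ε x s) t) (Icc 0 A.t₁) t := by
  simp only [θ_eq]
  exact (hk.const_mul (A.e x)).add (hq.diff ε hε t ht x hx h0 h1).2.hasDerivWithinAt

theorem u_dt_locallyIntegrable (hε : ε ∈ Ioo 0 A.ε₀) (ht : t ∈ Icc 0 A.t₁) :
    LocallyIntegrable fun x => A.dt (fun s => A.u ε x s) t := by
  simp only [fun x => dt_eq ht (u_hasDeriv hε ht x)]
  exact Continuous.locallyIntegrable (by fun_prop)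


/-- The weak form of the heat equation for `(ǔ, θ̌)` reduces to an expression concentrated at the
fronts. -/
theorem heatRelation_lhs_eq {J : Set ℝ} {qc qh : ℝ → ℝ → ℝ → ℝ} (hq : A.SolvesHeat J qc qh)
    (hε : ε ∈ Ioo 0 A.ε₀) (ht : t ∈ J) (ht' : t ∈ Icc 0 A.t₁) {ζ : ℝ → ℝ}
    (hζ : IsTest A.l₁ A.l₂ ζ) :
    (∫ x in Ioo A.l₁ A.l₂, (derivWithin (fun s => A.u ε x s) (Icc 0 A.t₁) t
        + derivWithin (fun s => A.θ qc qh ε x s) (Icc 0 A.t₁) t) * ζ x)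
      + (∫ x in Ioo A.l₁ A.l₂, deriv (fun y => A.θ qc qh ε y t) x * deriv ζ x)
    = (∫ x, A.dt (fun s => A.u ε x s) t * ζ x)
      - ∑ i : Fin 2, A.B (A.τ ε t) * (A.γp i t + A.γm i t) * ζ (A.φ i ε t) := by
  obtain ⟨g₀, g₁, g₂, hg₀, hg₁, hg₂, hK⟩ := exists_K_hasDerivWithinAt hε ht'
  set Kt := jumpFun (A.φ 0 ε t) (A.φ 1 ε t) g₀ g₁ g₂
  have lKt : LocallyIntegrable fun x => A.e x * Kt x :=
    (locallyIntegrable_jumpFun hg₀ hg₁ hg₂).continuous_mul A.e_test.continuous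
  have e1 := A.e_test.deriv
  have e2 : IsTest A.l₁ A.l₂ (iteratedDeriv 2 A.e) := by
    rw [iteratedDeriv_succ, iteratedDeriv_one]; exact e1.deriv
  have lT : LocallyIntegrable fun x => deriv A.e x * A.K ε x t + A.e x * A.Kx ε t x :=
    ((A.K_locallyIntegrable ε t).continuous_mul e1.continuous).add
      ((A.Kx_locallyIntegrable ε t).continuous_mul A.e_test.continuous)
  have lF : LocallyIntegrable fun x =>
      2 * deriv A.e x * A.Kx ε t x + iteratedDeriv 2 A.e x * A.K ε x t :=
    ((A.Kx_locallyIntegrable ε t).continuous_mul (continuous_const.mul e1.continuous)).add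
      ((A.K_locallyIntegrable ε t).continuous_mul e2.continuous)
  have i1 := (hζ.integrable_mul ((u_dt_locallyIntegrable hε ht').locallyIntegrableOn _)).integrableOn
    (s := Ioo A.l₁ A.l₂)
  have i2 := (hζ.integrable_mul (lKt.locallyIntegrableOn _)).integrableOn (s := Ioo A.l₁ A.l₂)
  have i3 := (hζ.integrable_mul (hq.int_t ε hε t ht)).integrableOn (s := Ioo A.l₁ A.l₂)
  have i4 := (hζ.deriv.integrable_mul (lT.locallyIntegrableOn _)).integrableOn
    (s := Ioo A.l₁ A.l₂)
  have i5 := (hζ.deriv.integrable_mul (hq.int_x ε hε t ht)).integrableOn (s := Ioo A.l₁ A.l₂)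
  have i6 := (hζ.integrable_mul (lF.locallyIntegrableOn _)).integrableOn (s := Ioo A.l₁ A.l₂)
  have i12 : IntegrableOn (fun x => A.dt (fun s => A.u ε x s) t * ζ x + A.e x * Kt x * ζ x)
      (Ioo A.l₁ A.l₂) := i1.add i2
  have E1 : ∫ x in Ioo A.l₁ A.l₂, (derivWithin (fun s => A.u ε x s) (Icc 0 A.t₁) t
        + derivWithin (fun s => A.θ qc qh ε x s) (Icc 0 A.t₁) t) * ζ x
      = (∫ x in Ioo A.l₁ A.l₂, A.dt (fun s => A.u ε x s) t * ζ x)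
        + (∫ x in Ioo A.l₁ A.l₂, A.e x * Kt x * ζ x)
        + ∫ x in Ioo A.l₁ A.l₂, A.dt (fun s => A.w qc qh ε x s) t * ζ x := by
    rw [← integral_add i1 i2, ← integral_add i12 i3]
    refine integral_congr_ae (ae_off_fronts ε t fun x hx h0 h1 => ?_)
    have := dt_eq ht' (θ_hasDerivWithinAt hq hε ht hx h0 h1 (hK x h0 h1))
    simp only [dt] at this ⊢
    simp only [this]
    ring
  have E2 : ∫ x in Ioo A.l₁ A.l₂, deriv (fun y => A.θ qc qh ε y t) x * deriv ζ x
      = (∫ x in Ioo A.l₁ A.l₂, (deriv A.e x * A.K ε x t + A.e x * A.Kx ε t x) * deriv ζ x)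
        + ∫ x in Ioo A.l₁ A.l₂, deriv (fun y => A.w qc qh ε y t) x * deriv ζ x := by
    rw [← integral_add i4 i5]
    refine integral_congr_ae (ae_off_fronts ε t fun x hx h0 h1 => ?_)
    simp only [(θ_hasDerivAt hq hε ht hx h0 h1).deriv]
    ring
  -- The integral of `e K_t ζ` split off here cancels the one in `E1`, so no information on `K_t`
  -- beyond integrability is needed.
  have E3 : ∫ x in Ioo A.l₁ A.l₂, A.F ε x t * ζ x
      = (∫ x in Ioo A.l₁ A.l₂,
          (2 * deriv A.e x * A.Kx ε t x + iteratedDeriv 2 A.e x * A.K ε x t) * ζ x)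
        - ∫ x in Ioo A.l₁ A.l₂, A.e x * Kt x * ζ x := by
    rw [← integral_sub i6 i2]
    refine integral_congr_ae (ae_off_fronts ε t fun x hx h0 h1 => ?_)
    simp only [F, dt_eq ht' (hK x h0 h1), (K_hasDerivAt h0 h1).deriv]
    ring
  have H := hq.eqn ε hε t ht ζ hζ
  have HK := integral_cutoff_K hε ht' hζ
  rw [E3] at H
  rw [E1, E2]
  rw [← hζ.setIntegral_eq, ← hζ.deriv.setIntegral_eq] at HK
  rw [← hζ.setIntegral_eq]
  linarith

end Ansatz

end PhaseField

open PhaseField PhaseField.Ansatz in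
theorem theorem1 (A : PhaseField.Ansatz) (J : Set ℝ) (hJ : J ⊆ Icc 0 A.t₁)
    (qc qh : ℝ → ℝ → ℝ → ℝ)
    (hq : A.SolvesHeat J qc qh)
    (hδ : A.DeltaCondition J) :
    PhaseField.HeatRelation A.l₁ A.l₂ A.t₁ A.ε₀ J A.u (A.θ qc qh) where
  cont_u ε hε := u_continuousOn hε _
  cont_θ ε hε := by
    simp only [θ_eq]
    exact ((A.e_test.continuous.comp continuous_fst).continuousOn.mul
      (K_continuousOn hε _)).add (hq.cont ε hε)
  diff ε hε t ht := by
    obtain ⟨g₀, g₁, g₂, -, -, -, hK⟩ := exists_K_hasDerivWithinAt hε (hJ ht)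
    refine ⟨{A.φ 0 ε t, A.φ 1 ε t}, fun x hx hS => ?_⟩
    rw [Finset.mem_insert, Finset.mem_singleton, not_or] at hS
    exact ⟨(u_hasDeriv hε (hJ ht) x).differentiableWithinAt,
      (θ_hasDerivWithinAt hq hε ht hx hS.1 hS.2 (hK x hS.1 hS.2)).differentiableWithinAt,
      (θ_hasDerivAt hq hε ht hx hS.1 hS.2).differentiableAt⟩
  int_t ε hε t ht := by
    obtain ⟨g₀, g₁, g₂, hg₀, hg₁, hg₂, hK⟩ := exists_K_hasDerivWithinAt hε (hJ ht)
    have h1 := ((locallyIntegrable_jumpFun (p := A.φ 0 ε t) (q := A.φ 1 ε t) hg₀ hg₁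
      hg₂).continuous_mul A.e_test.continuous).locallyIntegrableOn (Ioo A.l₁ A.l₂)
    refine (((u_dt_locallyIntegrable hε (hJ ht)).locallyIntegrableOn _).add
      (h1.add (hq.int_t ε hε t ht))).congr (ae_off_fronts ε t fun x hx h0 h1 => ?_)
    exact congrArg (_ + ·)
      (dt_eq (hJ ht) (θ_hasDerivWithinAt hq hε ht hx h0 h1 (hK x h0 h1))).symm
  int_x ε hε t ht := by
    have h1 : LocallyIntegrable fun x => deriv A.e x * A.K ε x t + A.e x * A.Kx ε t x :=
      ((A.K_locallyIntegrable ε t).continuous_mul A.e_test.deriv.continuous).add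
        ((A.Kx_locallyIntegrable ε t).continuous_mul A.e_test.continuous)
    exact ((h1.locallyIntegrableOn _).add (hq.int_x ε hε t ht)).congr
      (ae_off_fronts ε t fun x hx h0 h1 => (θ_hasDerivAt hq hε ht hx h0 h1).deriv.symm)
  estimate ζ hζ := by
    obtain ⟨C₁, h₁⟩ := u_weak_asymptotics hζ
    obtain ⟨C₂, h₂⟩ := hδ ζ hζ
    -- Inserting `∑ A_i ζ(φ_i)` between `∫ u_t ζ` and `∑ B (γ_i^+ + γ_i^-) ζ(φ_i)` gives one error
    -- from the weak asymptotics and one from the condition on the coefficients.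
    refine ⟨C₁ + C₂, fun ε hε t ht => ?_⟩
    have b₁ := h₁ ε hε t (hJ ht)
    have b₂ := h₂ ε hε t ht
    simp only [heatRelation_lhs_eq hq hε ht (hJ ht) hζ]
    simp only [sub_mul, Finset.sum_sub_distrib] at b₂
    rw [abs_le] at b₁ b₂ ⊢
    constructor <;> linarith [b₁.1, b₁.2, b₂.1, b₂.2]
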